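/- Let $X$ be a compact complex manifold of dimension $k$ and let $\pi_1,\pi_2: X\times X\to X$ be the two projections. Let $f$ be a meromorphic self-correspondence of $X$, given by its graph $\Gamma=\sum_j m_j\Gamma_j$, a finite sum with positive integer coefficients of irreducible $k$-dimensional analytic subsets $\Gamma_j$ of $X\times X$ such that $\pi_1(\Gamma_j)=\pi_2(\Gamma_j)=X$. For $n\ge 0$ let $\Gamma_n$ be the graph of the iterate $f^n$: here $f^0$ is the identity and $f^{n+1}=f\circ f^n$, where the graph of a composition $f_2\circ f_1$ is the sum of the irreducible $k$-dimensional analytic sets $C\subset X\times X$ projecting onto both factors, each counted with the number (with multiplicity) of points $y$ such that $(x,y)$ is in the graph of $f_1$ and $(y,z)$ in the graph of $f_2$, for generic $(x,z)\in C$. For a smooth form $\Phi$ on $X$ define the currents $(f^n)^*\Phi:=(\pi_1)_*([\Gamma_n]\wedge\pi_2^*\Phi)$ and $(f^n)_*\Phi:=(\pi_2)_*([\Gamma_n]\wedge\pi_1^*\Phi)$, that is, $$\langle (f^n)^*\Phi,\Psi\rangle=\int_{\Gamma_n}\pi_2^*\Phi\wedge\pi_1^*\Psi,\qquad \langle (f^n)_*\Phi,\Psi\rangle=\int_{\Gamma_n}\pi_1^*\Phi\wedge\pi_2^*\Psi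 .$$ Let $\omega$ and $\omega'$ be (the fundamental forms of) Hermitian metrics on $X$. For a current $T$ of bidegree $(p,q)$ let $\|T\|$ be its mass, the supremum of $|\langle T,\Psi\rangle|$ over smooth $(k-p,k-q)$-forms $\Psi$ of $\mathcal C^0$-norm at most $1$ with respect to $\omega'$. For $0\le q\le k$ let $$d_q:=\limsup_{n\to\infty}\Big(\int_X (f^n)^*\omega^q\wedge\omega^{k-q}\Big)^{1/n}=\limsup_{n\to\infty}\Big(\int_{\Gamma_n}\pi_2^*\omega^q\wedge\pi_1^*\omega^{k-q}\Big)^{1/n}\in[0,\infty]$$ be the dynamical degrees of $f$. Then for all $0\le p,q\le k$ and every smooth $(p,q)$-form $\Phi$ on $X$, $$\limsup_{n\to\infty}\|(f^n)^*\Phi\|^{1/n}\le\sqrt{d_p\,d_q},\qquad \limsup_{n\to\infty}\|(f^n)_*\Phi\|^{1/n}\le\sqrt{d_{k-p}\,d_{k-q}},$$ where each inequality is asserted whenever the product on its right-hand side is not of the indeterminate form $0\cdot\infty$. -/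

import Mathlib

open Set Filter Topology MeasureTheory
open scoped Manifold ContDiff ENNReal

namespace Corr

noncomputable section

/-! ### Differential forms on complex manifolds -/

section Forms

/-- Complex-valued (not necessarily smooth) differential forms of degree `n`: at each point an
alternating `ℝ`-multilinear form on the (real) tangent space. -/
abbrev DForm {F H : Type*} [NormedAddCommGroup F] [NormedSpace ℂ F] [TopologicalSpace H]
    (I : ModelWithCorners ℂ F H) (M : Type*) [TopologicalSpace M] [ChartedSpace H M] (n : ℕ) :
    Type _ :=
  ∀ x : M, (TangentSpace I x) [⋀^Fin n]→ₗ[ℝ] ℂ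

variable {F H : Type*} [NormedAddCommGroup F] [NormedSpace ℂ F] [TopologicalSpace H]
  {I : ModelWithCorners ℂ F H} {M : Type*} [TopologicalSpace M] [ChartedSpace H M]

/-- The exterior product of two alternating forms, normalised as the sum over shuffles
(so that `(a ∧ b)(u, v) = a u * b v - a v * b u` for two `1`-forms). -/
def wedgeAt {V : Type*} [AddCommGroup V] [Module ℝ V] {m n : ℕ}
    (a : V [⋀^Fin m]→ₗ[ℝ] ℂ) (b : V [⋀^Fin n]→ₗ[ℝ] ℂ) : V [⋀^Fin (m + n)]→ₗ[ℝ] ℂ :=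
  ((LinearMap.mul' ℝ ℂ).compAlternatingMap (a.domCoprod b)).domDomCongr finSumFinEquiv

/-- The exterior product of two differential forms. -/
def wedge {m n : ℕ} (α : DForm I M m) (β : DForm I M n) : DForm I M (m + n) :=
  fun x => wedgeAt (α x) (β x)

/-- The exterior power `α ∧ ⋯ ∧ α` (`q` factors) of a `2`-form; it is the constant `1` for
`q = 0`. -/
def wedgePow (α : DForm I M 2) : (q : ℕ) → DForm I M (2 * q)
  | 0 => fun _ => AlternatingMap.constOfIsEmpty ℝ _ (Fin 0) 1
  | q + 1 => wedge (wedgePow α q) α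

/-- The pullback `g^*β` of a differential form under a (holomorphic) map `g`. -/
def pullback {F' H' : Type*} [NormedAddCommGroup F'] [NormedSpace ℂ F'] [TopologicalSpace H']
    (I : ModelWithCorners ℂ F H) (I' : ModelWithCorners ℂ F' H')
    {N : Type*} [TopologicalSpace N] [ChartedSpace H' N] {n : ℕ}
    (g : M → N) (β : DForm I' N n) : DForm I M n :=
  fun x => (β (g x)).compLinearMap ((mfderiv I I' g x).toLinearMap.restrictScalars ℝ)

/-- `Φ` has bidegree `(p, q)`: in the decomposition of `(p + q)`-covectors into types, the
type-`(a, b)` part is the one on which multiplication of all arguments by `c ∈ ℂ` acts as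
`c ^ a * conj c ^ b`. -/
def IsBidegree (p q : ℕ) (Φ : DForm I M (p + q)) : Prop :=
  ∀ (x : M) (c : ℂ) (v : Fin (p + q) → TangentSpace I x),
    Φ x (fun i => c • v i) = c ^ p * (starRingEnd ℂ) c ^ q * Φ x v

end Forms

/-! ### Analytic sets -/

section Analytic

variable {F H : Type*} [NormedAddCommGroup F] [NormedSpace ℂ F] [TopologicalSpace H]
  (I : ModelWithCorners ℂ F H) {M : Type*} [TopologicalSpace M] [ChartedSpace H M]

/-- `A` is a (closed) analytic subset of the complex manifold `M`: every point of `M` has an open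
neighbourhood in which `A` is the common zero set of finitely many holomorphic functions. -/
def IsAnalyticSubset (A : Set M) : Prop :=
  ∀ a : M, ∃ U : Set M, IsOpen U ∧ a ∈ U ∧ ∃ (m : ℕ) (g : Fin m → M → ℂ),
    (∀ i, ContMDiffOn I 𝓘(ℂ, ℂ) ω (g i) U) ∧ A ∩ U = {x | x ∈ U ∧ ∀ i, g i x = 0}

/-- `A` is an irreducible analytic subset: it is nonempty and not the union of two analytic
subsets different from `A`. -/
def IsIrreducibleAnalytic (A : Set M) : Prop :=
  A.Nonempty ∧ IsAnalyticSubset I A ∧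
    ∀ B C : Set M, IsAnalyticSubset I B → IsAnalyticSubset I C → A = B ∪ C → A = B ∨ A = C

end Analytic

/-! ### Compact complex manifolds of dimension `k`, and subsets of dimension `k` of the square -/

/-- The space `ℂ^k` on which complex manifolds of dimension `k` are modelled. -/
abbrev Model (k : ℕ) : Type := Fin k → ℂ

/-- The model of `X × X`, for `X` a complex manifold of dimension `k`. -/
abbrev sqModel (k : ℕ) :
    ModelWithCorners ℂ (Model k × Model k) (ModelProd (Model k) (Model k)) :=
  (𝓘(ℂ, Model k)).prod 𝓘(ℂ, Model k)

variable {k : ℕ} {X : Type*} [TopologicalSpace X] [ChartedSpace (Model k) X]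

/-- A differential form on `X` is smooth if its coefficients in the charts of `X` are `C^∞`
functions (in the real sense). -/
def IsSmoothForm {n : ℕ} (Φ : DForm 𝓘(ℂ, Model k) X n) : Prop :=
  ∀ e ∈ atlas (Model k) X, ∀ v : Fin n → Model k,
    ContDiffOn ℝ ∞ (fun u : Model k => pullback 𝓘(ℂ, Model k) 𝓘(ℂ, Model k) e.symm Φ u v) e.target

variable (k X) in
/-- A Hermitian metric on `X`, given by its fundamental form: a smooth real `(1, 1)`-form `η`
which is strictly positive, i.e. `η(v, iv) > 0` for every nonzero tangent vector `v`. -/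
structure HermitianForm where
  form : DForm 𝓘(ℂ, Model k) X 2
  smooth : IsSmoothForm form
  bidegree : IsBidegree 1 1 form
  real : ∀ x v, (form x v).im = 0
  pos : ∀ (x : X) (v : TangentSpace 𝓘(ℂ, Model k) x), v ≠ 0 →
    0 < (form x ![v, Complex.I • v]).re

/-- `Ψ` has `C^0`-norm at most `1` with respect to the Hermitian metric `η`. -/
def UnitBounded (η : HermitianForm k X) {n : ℕ} (Ψ : DForm 𝓘(ℂ, Model k) X n) : Prop :=
  ∀ (x : X) (v : Fin n → TangentSpace 𝓘(ℂ, Model k) x),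
    (∀ i, (η.form x ![v i, Complex.I • v i]).re ≤ 1) → ‖Ψ x v‖ ≤ 1

/-- `ψ` is a slice chart for `A ⊆ X × X`: a holomorphic chart of `X × X` with values in
`ℂ^k × ℂ^k` in which `A` is the linear subspace `ℂ^k × {0}`. -/
def IsSliceChart (A : Set (X × X))
    (ψ : OpenPartialHomeomorph (X × X) (ModelProd (Model k) (Model k))) : Prop :=
  ψ ∈ IsManifold.maximalAtlas (sqModel k) ω (X × X) ∧
    ∀ z ∈ ψ.source, z ∈ A ↔ (ψ z).2 = 0

variable (k) in
/-- The points of `A ⊆ X × X` near which `A` is a complex submanifold of dimension `k`. -/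
def regLocus (A : Set (X × X)) : Set (X × X) :=
  {z | z ∈ A ∧ ∃ ψ : OpenPartialHomeomorph (X × X) (ModelProd (Model k) (Model k)),
    IsSliceChart A ψ ∧ z ∈ ψ.source}

variable (k) in
/-- `A` is an irreducible analytic subset of `X × X` of dimension `k` whose two projections to `X`
are both equal to `X`. -/
def IsDominant (A : Set (X × X)) : Prop :=
  IsIrreducibleAnalytic (sqModel k) A ∧ (regLocus k A).Nonempty ∧
    Prod.fst '' A = univ ∧ Prod.snd '' A = univ

/-! ### Integration of forms of top degree over a set of dimension `k` -/

/-- The regular locus of `A` is covered by countably many slice charts. -/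
theorem exists_sliceCover [CompactSpace X] (A : Set (X × X)) (hA : (regLocus k A).Nonempty) :
    ∃ ψ : ℕ → OpenPartialHomeomorph (X × X) (ModelProd (Model k) (Model k)),
      (∀ i, IsSliceChart A (ψ i)) ∧ regLocus k A ⊆ ⋃ i, (ψ i).source := by
  have hX : SecondCountableTopology X :=
    ChartedSpace.secondCountable_of_sigmaCompact (Model k) X
  let T := {ψ : OpenPartialHomeomorph (X × X) (ModelProd (Model k) (Model k)) //
    IsSliceChart A ψ}
  obtain ⟨S, hS, hU⟩ := TopologicalSpace.isOpen_iUnion_countable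
    (fun ψ : T => ψ.1.source) (fun ψ => ψ.1.open_source)
  have hsub : regLocus k A ⊆ ⋃ ψ ∈ S, (ψ : T).1.source := by
    rintro z ⟨-, ψ, hψ, hz⟩
    rw [hU]
    exact mem_iUnion.2 ⟨⟨ψ, hψ⟩, hz⟩
  have hne : S.Nonempty := by
    obtain ⟨z, hz⟩ := hA
    obtain ⟨ψ, hψ, -⟩ := mem_iUnion₂.1 (hsub hz)
    exact ⟨ψ, hψ⟩
  obtain ⟨f, hf⟩ := hS.exists_eq_range hne
  refine ⟨fun i => (f i).1, fun i => (f i).2, fun z hz => ?_⟩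
  obtain ⟨ψ, hψ, hzψ⟩ := mem_iUnion₂.1 (hsub hz)
  rw [hf] at hψ
  obtain ⟨i, rfl⟩ := hψ
  exact mem_iUnion.2 ⟨i, hzψ⟩

/-- The holomorphic parametrisation `u ↦ ψ⁻¹(u, 0)` of `A` given by a slice chart. -/
def sliceParam (ψ : OpenPartialHomeomorph (X × X) (ModelProd (Model k) (Model k))) :
    Model k → X × X :=
  fun u => ψ.symm (u, 0)

/-- The parameters of the points of the `i`-th chart which lie in no earlier chart. The images of
these (Borel) sets under the parametrisations are disjoint and fill the union of the charts. -/
def slicePiece (ψ : ℕ → OpenPartialHomeomorph (X × X) (ModelProd (Model k) (Model k))) (i : ℕ) :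
    Set (Model k) :=
  {u | ((u, 0) : ModelProd (Model k) (Model k)) ∈ (ψ i).target ∧
    ∀ j < i, sliceParam (ψ i) u ∉ (ψ j).source}

variable (k) in
/-- The real basis `e₁, i e₁, …, e_k, i e_k` of `ℂ^k`, defining its complex orientation. -/
def frame (j : Fin (2 * k)) : Model k :=
  Pi.single ⟨j / 2, by omega⟩ (if (j : ℕ) % 2 = 0 then 1 else Complex.I)

/-- The function `g` such that the pullback of the form `β` of degree `2k` under the
parametrisation of `A` is `g dx₁ ∧ dy₁ ∧ ⋯ ∧ dx_k ∧ dy_k`. -/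
def sliceDensity {n : ℕ} (hn : n = 2 * k) (β : DForm (sqModel k) (X × X) n)
    (ψ : OpenPartialHomeomorph (X × X) (ModelProd (Model k) (Model k))) (u : Model k) : ℂ :=
  pullback 𝓘(ℂ, Model k) (sqModel k) (sliceParam ψ) β u (fun j => frame k (Fin.cast hn j))

open Classical in
/-- The integral `∫_A β` over the regular locus of `A` of a form `β` of degree `2k`, that is the
value on `β` of the current of integration `[A]`. It is computed by cutting the regular locus into
countably many pieces, each in one slice chart; by the change of variables formula the choice of
the pieces is irrelevant. -/
def integral [CompactSpace X] {n : ℕ} (hn : n = 2 * k) (A : Set (X × X))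
    (β : DForm (sqModel k) (X × X) n) : ℂ :=
  if h : (regLocus k A).Nonempty then
    let ψ := Classical.choose (exists_sliceCover A h)
    ∑' i, ∫ u in slicePiece ψ i, sliceDensity hn β (ψ i) u
  else 0

open Classical in
/-- The integral `∫_A β ∈ [0, ∞]` of a form `β` of degree `2k` which is nonnegative on `A`. -/
def posIntegral [CompactSpace X] {n : ℕ} (hn : n = 2 * k) (A : Set (X × X))
    (β : DForm (sqModel k) (X × X) n) : ℝ≥0∞ :=
  if h : (regLocus k A).Nonempty then
    let ψ := Classical.choose (exists_sliceCover A h)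
    ∑' i, ∫⁻ u in slicePiece ψ i, ENNReal.ofReal (sliceDensity hn β (ψ i) u).re
  else 0

/-! ### Cycles, correspondences and their iterates -/

/-- An effective cycle `∑ m_A A` on `X × X`, given by its multiplicities `m_A`. -/
abbrev Cycle (X : Type*) : Type _ := Set (X × X) → ℕ

variable (k X) in
/-- A (dominant) meromorphic self-correspondence of `X`, given by its graph: a finite sum, with
positive integral multiplicities, of irreducible analytic subsets of `X × X` of dimension `k`
whose two projections are equal to `X`. -/
structure MeroCorr where
  graph : Cycle X
  finite : (Function.support graph).Finite
  dominant : ∀ A, graph A ≠ 0 → IsDominant k A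

open Classical in
/-- The sum of the multiplicities of those components of a cycle which pass through a point. -/
def multAt (Γ : Cycle X) (z : X × X) : ℝ≥0∞ :=
  ∑' A : Set (X × X), if z ∈ A then (Γ A : ℝ≥0∞) else 0

variable (k) in
/-- At the generic point `(x, z)` of `C` (outside a proper analytic subset of `C`), the number of
`y` with `(x, y) ∈ Γ₁` and `(y, z) ∈ Γ₂`, counted with the multiplicities of the components, is
`N`. -/
def IsGenericCount (Γ₂ Γ₁ : Cycle X) (C : Set (X × X)) (N : ℕ) : Prop :=
  ∃ Z : Set (X × X), IsAnalyticSubset (sqModel k) Z ∧ Z ⊂ C ∧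
    ∀ x z : X, (x, z) ∈ C → (x, z) ∉ Z →
      ∑' y : X, multAt Γ₁ (x, y) * multAt Γ₂ (y, z) = (N : ℝ≥0∞)

open Classical in
variable (k) in
/-- The graph of the composition `f₂ ∘ f₁` of correspondences with graphs `Γ₂`, `Γ₁`: its
components are the irreducible `k`-dimensional analytic sets `C`, projecting onto both factors,
whose points `(x, z)` are of the form `(x, y) ∈ Γ₁`, `(y, z) ∈ Γ₂`; the multiplicity of `C` is the
number of such `y` over the generic point of `C`. -/
def comp (Γ₂ Γ₁ : Cycle X) : Cycle X := fun C =>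
  if h : IsDominant k C ∧ ∃ N, IsGenericCount k Γ₂ Γ₁ C N then Classical.choose h.2 else 0

open Classical in
variable (k) in
/-- The graph `Γ_n` of the `n`-th iterate `f^n`, where `f^0` is the identity and
`f^(n+1) = f ∘ f^n`. -/
def iter (Γ : Cycle X) : ℕ → Cycle X
  | 0 => fun A => if A = diagonal X then 1 else 0
  | n + 1 => comp k Γ (iter Γ n)

/-- The integral of a form of degree `2k` over a cycle. -/
def cycleIntegral [CompactSpace X] {n : ℕ} (hn : n = 2 * k) (Γ : Cycle X)
    (β : DForm (sqModel k) (X × X) n) : ℂ :=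
  ∑' A : Set (X × X), (Γ A : ℂ) * integral hn A β

/-- The integral in `[0, ∞]` of a form of degree `2k`, nonnegative on the cycle. -/
def cyclePosIntegral [CompactSpace X] {n : ℕ} (hn : n = 2 * k) (Γ : Cycle X)
    (β : DForm (sqModel k) (X × X) n) : ℝ≥0∞ :=
  ∑' A : Set (X × X), (Γ A : ℝ≥0∞) * posIntegral hn A β

/-- The pullback `π₁^*Φ` of a form on `X` under the first projection `X × X → X`. -/
def pull₁ {n : ℕ} (Φ : DForm 𝓘(ℂ, Model k) X n) : DForm (sqModel k) (X × X) n :=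
  pullback (sqModel k) 𝓘(ℂ, Model k) (Prod.fst : X × X → X) Φ

/-- The pullback `π₂^*Φ` of a form on `X` under the second projection `X × X → X`. -/
def pull₂ {n : ℕ} (Φ : DForm 𝓘(ℂ, Model k) X n) : DForm (sqModel k) (X × X) n :=
  pullback (sqModel k) 𝓘(ℂ, Model k) (Prod.snd : X × X → X) Φ

/-- The current `g^*Φ = (π₁)_*([Γ] ∧ π₂^*Φ)`, for a correspondence `g` with graph `Γ`, as a
functional on test forms `Ψ` of complementary degree:
`⟨g^*Φ, Ψ⟩ = ∫_Γ π₂^*Φ ∧ π₁^*Ψ`. -/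
def pullCurrent [CompactSpace X] (Γ : Cycle X) {m n : ℕ} (h : m + n = 2 * k)
    (Φ : DForm 𝓘(ℂ, Model k) X m) (Ψ : DForm 𝓘(ℂ, Model k) X n) : ℂ :=
  cycleIntegral h Γ (wedge (pull₂ Φ) (pull₁ Ψ))

/-- The current `g_*Φ = (π₂)_*([Γ] ∧ π₁^*Φ)`, for a correspondence `g` with graph `Γ`, as a
functional on test forms `Ψ` of complementary degree:
`⟨g_*Φ, Ψ⟩ = ∫_Γ π₁^*Φ ∧ π₂^*Ψ`. -/
def pushCurrent [CompactSpace X] (Γ : Cycle X) {m n : ℕ} (h : m + n = 2 * k)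
    (Φ : DForm 𝓘(ℂ, Model k) X m) (Ψ : DForm 𝓘(ℂ, Model k) X n) : ℂ :=
  cycleIntegral h Γ (wedge (pull₁ Φ) (pull₂ Ψ))

/-- The mass `‖T‖`, with respect to the Hermitian metric `η`, of a current `T` whose test forms
are the smooth forms of bidegree `(r, s)`: the supremum of `|⟨T, Ψ⟩|` over the smooth
`(r, s)`-forms `Ψ` of `C^0`-norm at most `1`. -/
def mass (η : HermitianForm k X) {r s : ℕ} (T : DForm 𝓘(ℂ, Model k) X (r + s) → ℂ) : ℝ≥0∞ :=
  ⨆ (Ψ : DForm 𝓘(ℂ, Model k) X (r + s))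
    (_ : IsSmoothForm Ψ ∧ IsBidegree r s Ψ ∧ UnitBounded η Ψ), ‖T Ψ‖ₑ

/-- The dynamical degree
`d_q(f) = limsup_n (∫_X (f^n)^*η^q ∧ η^(k-q))^(1/n) ∈ [0, ∞]`; the integral is that of the positive
form `π₂^*η^q ∧ π₁^*η^(k-q)` over the graph of `f^n`. -/
def dynDegree [CompactSpace X] (η : HermitianForm k X) (f : MeroCorr k X) (q : ℕ) (hq : q ≤ k) :
    ℝ≥0∞ :=
  limsup (fun n : ℕ =>
    cyclePosIntegral (show 2 * q + 2 * (k - q) = 2 * k by omega) (iter k f.graph n)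
      (wedge (pull₂ (wedgePow η.form q)) (pull₁ (wedgePow η.form (k - q)))) ^ (1 / (n : ℝ))) atTop

end

end Corr

/-!
The inequality holds for each iterate separately, with a constant that does not depend on the
iterate: for every cycle `Γ` on `X × X`, with `a_p(Γ) = ∫_Γ π₂^*η^p ∧ π₁^*η^(k-p)`,
`‖(π₁)_*([Γ] ∧ π₂^*Φ)‖ ≤ C √(a_p(Γ) a_q(Γ))`, where `C` depends only on `X`, the two metrics and
`Φ`. Taking `n`-th roots gives the theorem, and nothing about composition is needed.

The estimate for one cycle is a Cauchy–Schwarz inequality, which is pointwise at bottom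
(`norm_wedgeAt_frame_le`). At a regular point of `Γ`, let `x_j` and `y_j` be the linear forms on
the tangent space of `Γ` obtained by pulling back coordinates, unitary for `η`, from the second and
the first factor. Then `π₂^*Φ ∧ π₁^*Ψ` is a combination with bounded coefficients of products
`x_I ∧ conj x_J ∧ y_K ∧ conj y_L` with `|I| = p`, `|J| = q`, `|K| = k - p`, `|L| = k - q`. On the
oriented frame such a product is, up to a factor of modulus `2^k`, the determinant of `(x_I, y_K)`
times the conjugate of that of `(x_J, y_L)`. On the other hand the density of
`π₂^*η^p ∧ π₁^*η^(k-p)` is exactly the sum of the squares of the moduli of all determinants of the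
first kind (`wedgeAt_wedgePowAt_frame`), and the same holds for `q` and the second kind.

The integrated inequality (`enorm_cycleIntegral_le`) follows by the Cauchy–Schwarz inequalities for
integrals and sums; the former needs the densities to be measurable on the slice charts, which holds
because they are continuous (`continuousOn_sliceDensity`). The constant is uniform because on a
compact manifold a smooth form is bounded with respect to any Hermitian metric
(`IsSmoothForm.exists_bound`), so that, in particular, any two metrics are comparable.
-/

namespace Corr

/-! ### Exterior products as alternatizations -/

section Alternatization

variable {V : Type*} [AddCommGroup V] [Module ℝ V]

/-- The (non-alternating) product `(u, v) ↦ a(u) b(v)` of two multilinear forms. -/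
noncomputable def mulTensor {m n : ℕ} (a : MultilinearMap ℝ (fun _ : Fin m => V) ℂ)
    (b : MultilinearMap ℝ (fun _ : Fin n => V) ℂ) :
    MultilinearMap ℝ (fun _ : Fin (m + n) => V) ℂ :=
  ((LinearMap.mul' ℝ ℂ).compMultilinearMap (a.domCoprod b)).domDomCongr finSumFinEquiv

theorem mulTensor_apply {m n : ℕ} (a : MultilinearMap ℝ (fun _ : Fin m => V) ℂ)
    (b : MultilinearMap ℝ (fun _ : Fin n => V) ℂ) (v : Fin (m + n) → V) :
    mulTensor a b v = a (fun i => v (Fin.castAdd n i)) * b (fun i => v (Fin.natAdd m i)) := by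
  simp [mulTensor]

/-- With the shuffle normalisation of `wedgeAt`, alternatization turns products into exterior
products, without any factorials. -/
theorem wedgeAt_alternatization {m n : ℕ} (a : MultilinearMap ℝ (fun _ : Fin m => V) ℂ)
    (b : MultilinearMap ℝ (fun _ : Fin n => V) ℂ) :
    wedgeAt (MultilinearMap.alternatization a) (MultilinearMap.alternatization b) =
      MultilinearMap.alternatization (mulTensor a b) := by
  rw [wedgeAt, ← MultilinearMap.domCoprod_alternization,
    ← LinearMap.compMultilinearMap_alternatization]
  ext v
  simp only [mulTensor, AlternatingMap.domDomCongr_apply, MultilinearMap.alternatization_apply,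
    MultilinearMap.domDomCongr_apply]
  refine Fintype.sum_equiv (Equiv.permCongr finSumFinEquiv) _ _ fun σ => ?_
  simp [Equiv.Perm.sign_permCongr]

/-- The product `v ↦ ∏ i, ξ i (v i)` of linear forms. -/
noncomputable def monomial {ι : Type*} [Fintype ι] (ξ : ι → V →ₗ[ℝ] ℂ) :
    MultilinearMap ℝ (fun _ : ι => V) ℂ :=
  (MultilinearMap.mkPiAlgebra ℝ ι ℂ).compLinearMap ξ

@[simp] theorem monomial_apply {ι : Type*} [Fintype ι] (ξ : ι → V →ₗ[ℝ] ℂ) (v : ι → V) :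
    monomial ξ v = ∏ i, ξ i (v i) := by
  simp [monomial]

/-- The exterior product of linear forms is a determinant. -/
theorem alternatization_monomial {ι : Type*} [Fintype ι] [DecidableEq ι] (ξ : ι → V →ₗ[ℝ] ℂ)
    (v : ι → V) :
    MultilinearMap.alternatization (monomial ξ) v = (Matrix.of fun i j => ξ i (v j)).det := by
  rw [← Matrix.det_transpose, Matrix.det_apply, MultilinearMap.alternatization_apply]
  simp

theorem mulTensor_monomial {m n : ℕ} (ξ : Fin m → V →ₗ[ℝ] ℂ) (ζ : Fin n → V →ₗ[ℝ] ℂ) :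
    mulTensor (monomial ξ) (monomial ζ) = monomial (Fin.append ξ ζ) := by
  ext v
  simp [mulTensor_apply, Fin.prod_univ_add]

theorem alternatization_smul_apply {ι : Type*} [Fintype ι] [DecidableEq ι] (c : ℂ)
    (m : MultilinearMap ℝ (fun _ : ι => V) ℂ) (v : ι → V) :
    MultilinearMap.alternatization (c • m) v = c * MultilinearMap.alternatization m v := by
  simp only [MultilinearMap.alternatization_apply, Finset.mul_sum,
    MultilinearMap.domDomCongr_apply, smul_apply, smul_eq_mul, mul_smul_comm]

theorem alternatization_sum_apply {ι κ : Type*} [Fintype ι] [DecidableEq ι] (s : Finset κ)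
    (m : κ → MultilinearMap ℝ (fun _ : ι => V) ℂ) (v : ι → V) :
    MultilinearMap.alternatization (∑ j ∈ s, m j) v =
      ∑ j ∈ s, MultilinearMap.alternatization (m j) v := by
  simp only [MultilinearMap.alternatization_apply, MultilinearMap.domDomCongr_apply, sum_apply,
    Finset.smul_sum]
  exact Finset.sum_comm

/-- Every alternating form is an alternatization, so that `wedgeAt_alternatization` applies. -/
theorem eq_alternatization {n : ℕ} (α : V [⋀^Fin n]→ₗ[ℝ] ℂ) :
    α = MultilinearMap.alternatization
      (((n.factorial : ℂ)⁻¹) • (α : MultilinearMap ℝ (fun _ : Fin n => V) ℂ)) := by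
  ext v
  rw [alternatization_smul_apply, AlternatingMap.coe_alternatization, Fintype.card_fin,
    AlternatingMap.smul_apply, nsmul_eq_mul,
    inv_mul_cancel_left₀ (by exact_mod_cast n.factorial_ne_zero)]

end Alternatization

/-! ### Forms of type `(1, 0)` and `(0, 1)` -/

section Typed

variable {V : Type*} [AddCommGroup V] [Module ℂ V] [Module ℝ V] [IsScalarTower ℝ ℂ V]

/-- The complex linear form `ℓ` if `s = true`, and its complex conjugate if `s = false`. -/
noncomputable def typed (ℓ : V →ₗ[ℂ] ℂ) (s : Bool) : V →ₗ[ℝ] ℂ :=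
  if s then ℓ.restrictScalars ℝ else Complex.conjAe.toLinearMap.comp (ℓ.restrictScalars ℝ)

@[simp] theorem typed_true (ℓ : V →ₗ[ℂ] ℂ) (v : V) : typed ℓ true v = ℓ v := rfl

@[simp] theorem typed_false (ℓ : V →ₗ[ℂ] ℂ) (v : V) :
    typed ℓ false v = (starRingEnd ℂ) (ℓ v) := rfl

/-- Expansion of a real multilinear form in products of the coordinates `z_j` and `conj z_j`. -/
theorem exists_expansion {κ ι : Type*} [Fintype κ] [Fintype ι] [DecidableEq ι]
    (b : Module.Basis κ ℂ V)
    (α : MultilinearMap ℝ (fun _ : ι => V) ℂ) {R : ℝ}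
    (hR : ∀ v : ι → V, (∀ i, ∃ j, v i = b j ∨ v i = Complex.I • b j) → ‖α v‖ ≤ R) :
    ∃ A : (ι → κ × Bool) → ℂ, (∀ σ, ‖A σ‖ ≤ R) ∧
      ∀ v, α v = ∑ σ, A σ * ∏ i, typed (b.coord (σ i).1) (σ i).2 (v i) := by
  classical
  -- `B (j, t)` is the real basis `b j, i b j`; its dual coordinates are combinations, with
  -- coefficients `c t s` of modulus `1 / 2`, of `z_j` and `conj z_j`.
  let B : κ × Bool → V := fun t => if t.2 then b t.1 else Complex.I • b t.1
  let c : Bool → Bool → ℂ := fun t s => if t then 1 / 2 else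
    if s then -Complex.I / 2 else Complex.I / 2
  let x : κ × Bool → V → ℝ := fun t v => if t.2 then (b.coord t.1 v).re else (b.coord t.1 v).im
  have hx : ∀ t v, (x t v : ℂ) = ∑ s : Bool, c t.2 s * typed (b.coord t.1) s v := by
    rintro ⟨j, t⟩ v
    generalize hw : b.repr v j = w
    cases t
    · simp [x, c, hw, Complex.ext_iff]
      constructor <;> ring
    · simp [x, c, hw, Complex.ext_iff]
      ring
  have hv : ∀ v : V, v = ∑ t, x t v • B t := by
    intro v
    conv_lhs => rw [← b.sum_repr v]
    rw [Fintype.sum_prod_type]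
    refine Finset.sum_congr rfl fun j _ => ?_
    simp only [Fintype.sum_bool, x, B, if_true, Bool.false_eq_true, if_false, Module.Basis.coord_apply]
    rw [← algebraMap_smul ℂ (b.repr v j).re, ← algebraMap_smul ℂ (b.repr v j).im, smul_smul,
      ← add_smul]
    congr 1
    simp [Complex.re_add_im]
  have hc : ∀ t s, ‖c t s‖ = 1 / 2 := by
    intro t s
    cases t <;> cases s <;> simp [c]
  refine ⟨fun σ => ∑ τ : ι → Bool, α (fun i => B ((σ i).1, τ i)) * ∏ i, c (τ i) (σ i).2,
    fun σ => ?_, fun v => ?_⟩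
  · refine (norm_sum_le _ _).trans ?_
    have : ∀ τ ∈ (Finset.univ : Finset (ι → Bool)),
        ‖α (fun i => B ((σ i).1, τ i)) * ∏ i, c (τ i) (σ i).2‖
          ≤ R * (1 / 2) ^ Fintype.card ι := by
      intro τ _
      rw [norm_mul, norm_prod]
      simp only [hc, Finset.prod_const, Finset.card_univ]
      gcongr
      refine hR _ fun i => ⟨(σ i).1, ?_⟩
      cases τ i <;> simp [B]
    refine (Finset.sum_le_sum this).trans (le_of_eq ?_)
    simp only [Finset.sum_const, Finset.card_univ, Fintype.card_fun, Fintype.card_bool, nsmul_eq_mul]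
    push_cast
    rw [mul_left_comm, ← mul_pow]
    norm_num
  · have h1 : α v = ∑ ρ : ι → κ × Bool, (∏ i, (x (ρ i) (v i) : ℂ)) * α (fun i => B (ρ i)) := by
      conv_lhs => rw [show v = fun i => ∑ t, x t (v i) • B t from funext fun i => hv (v i)]
      rw [MultilinearMap.map_sum]
      refine Finset.sum_congr rfl fun ρ _ => ?_
      rw [MultilinearMap.map_smul_univ, Complex.real_smul]
      push_cast
      rfl
    rw [h1]
    simp_rw [hx, Finset.prod_univ_sum, Fintype.piFinset_univ, Finset.sum_mul,
      Finset.prod_mul_distrib]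
    -- both sides are sums over an index `κ` and two types `Bool` in each slot
    rw [← (Equiv.arrowProdEquivProdArrow ι (fun _ => κ) (fun _ => Bool)).symm.sum_comp,
      ← (Equiv.arrowProdEquivProdArrow ι (fun _ => κ) (fun _ => Bool)).symm.sum_comp,
      Fintype.sum_prod_type, Fintype.sum_prod_type]
    refine Finset.sum_congr rfl fun j _ => ?_
    rw [Finset.sum_comm]
    refine Finset.sum_congr rfl fun s _ => ?_
    refine Finset.sum_congr rfl fun t _ => ?_
    simp only [Equiv.arrowProdEquivProdArrow, Equiv.coe_fn_symm_mk]
    ring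

/-- In the expansion of a form of bidegree `(p, q)` only the products with exactly `p` holomorphic
factors occur: both sides are polynomials in `c` after replacing `v` by `c • v`, `|c| = 1`. -/
theorem exists_bidegree_expansion {κ : Type*} [Fintype κ] (b : Module.Basis κ ℂ V) {p q : ℕ}
    (α : V [⋀^Fin (p + q)]→ₗ[ℝ] ℂ) {R : ℝ} (hR0 : 0 ≤ R)
    (hα : ∀ (c : ℂ) v, α (fun i => c • v i) = c ^ p * (starRingEnd ℂ) c ^ q * α v)
    (hR : ∀ v : Fin (p + q) → V, (∀ i, ∃ j, v i = b j ∨ v i = Complex.I • b j) → ‖α v‖ ≤ R) :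
    ∃ A : (Fin (p + q) → κ × Bool) → ℂ, (∀ σ, ‖A σ‖ ≤ R) ∧
      (∀ σ, A σ ≠ 0 → Fintype.card {i // (σ i).2 = true} = p) ∧
      ∀ v, α v = ∑ σ, A σ * ∏ i, typed (b.coord (σ i).1) (σ i).2 (v i) := by
  classical
  obtain ⟨A, hAR, hA⟩ := exists_expansion b
    (α : MultilinearMap ℝ (fun _ : Fin (p + q) => V) ℂ) hR
  let N : (Fin (p + q) → κ × Bool) → ℕ := fun σ => Fintype.card {i // (σ i).2 = true}
  refine ⟨fun σ => if N σ = p then A σ else 0, fun σ => ?_, fun σ => ?_, fun v => ?_⟩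
  · dsimp only
    split_ifs
    · exact hAR σ
    · simpa using hR0
  · intro h
    by_contra h'
    exact h (if_neg h')
  let T : (Fin (p + q) → κ × Bool) → ℂ := fun σ =>
    A σ * ∏ i, typed (b.coord (σ i).1) (σ i).2 (v i)
  let P : Polynomial ℂ := (∑ σ, Polynomial.C (T σ) * Polynomial.X ^ (2 * N σ))
    - Polynomial.C (α v) * Polynomial.X ^ (2 * p)
  have hP : P = 0 := by
    have hinf : (Metric.sphere (0 : ℂ) 1).Infinite := by
      refine (isPreconnected_sphere ?_ 0 1).infinite_of_nontrivial ?_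
      · simp [Complex.rank_real_complex]
      · exact ⟨1, by simp, -1, by simp, by norm_num⟩
    refine Polynomial.eq_zero_of_infinite_isRoot P (hinf.mono fun c hc => ?_)
    have hc1 : c * (starRingEnd ℂ) c = 1 := by
      rw [Complex.mul_conj, Complex.normSq_eq_norm_sq, mem_sphere_zero_iff_norm.1 hc]
      simp
    have hpow : ∀ a d : ℕ, a + d = p + q →
        c ^ (p + q) * (c ^ a * (starRingEnd ℂ) c ^ d) = c ^ (2 * a) := by
      intro a d h
      rw [← h]
      calc _ = c ^ (2 * a) * (c * (starRingEnd ℂ) c) ^ d := by ring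
        _ = _ := by rw [hc1]; simp
    have h1 := hα c v
    have h2 := hA (fun i => c • v i)
    rw [AlternatingMap.coe_multilinearMap, h1] at h2
    have h3 : ∀ σ : Fin (p + q) → κ × Bool,
        ∏ i, typed (b.coord (σ i).1) (σ i).2 (c • v i) =
          c ^ N σ * (starRingEnd ℂ) c ^ (p + q - N σ) *
            ∏ i, typed (b.coord (σ i).1) (σ i).2 (v i) := by
      intro σ
      have h4 : ∀ i, typed (b.coord (σ i).1) (σ i).2 (c • v i) =
          (if (σ i).2 = true then c else (starRingEnd ℂ) c) *
            typed (b.coord (σ i).1) (σ i).2 (v i) := by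
        intro i
        cases h : (σ i).2 <;> simp
      simp_rw [h4, Finset.prod_mul_distrib, Finset.prod_ite, Finset.prod_const]
      have h5 : (Finset.univ.filter fun i => (σ i).2 = true).card = N σ :=
        (Fintype.card_subtype _).symm
      have h6 : (Finset.univ.filter fun i => ¬ (σ i).2 = true).card = p + q - N σ := by
        have := Finset.card_filter_add_card_filter_not (s := (Finset.univ : Finset (Fin (p + q))))
          (fun i => (σ i).2 = true)
        rw [h5, Finset.card_univ, Fintype.card_fin] at this
        omega
      rw [h5, h6]
    have hN : ∀ σ, N σ + (p + q - N σ) = p + q := by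
      intro σ
      have : N σ ≤ p + q := by
        simpa using Fintype.card_subtype_le fun i => (σ i).2 = true
      omega
    simp only [P, mem_ofPred_eq, Polynomial.IsRoot, Polynomial.eval_sub, Polynomial.eval_finsetSum,
      Polynomial.eval_mul, Polynomial.eval_C, Polynomial.eval_pow, Polynomial.eval_X]
    have h5 := congrArg (fun z => c ^ (p + q) * z) h2
    simp only [h3, Finset.mul_sum] at h5
    rw [← mul_assoc, hpow p q rfl] at h5
    rw [sub_eq_zero, mul_comm (α v), h5]
    refine Finset.sum_congr rfl fun σ _ => ?_
    rw [← hpow _ _ (hN σ)]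
    ring
  have h7 := congrArg (fun Q => Polynomial.coeff Q (2 * p)) hP
  simp only [P, Polynomial.coeff_sub, Polynomial.finsetSum_coeff, Polynomial.coeff_C_mul_X_pow,
    Polynomial.coeff_zero, if_true] at h7
  rw [sub_eq_zero] at h7
  rw [← h7]
  refine Finset.sum_congr rfl fun σ _ => ?_
  by_cases h : N σ = p
  · simp [h, T]
  · have : ¬ 2 * p = 2 * N σ := by omega
    simp [h, this]

end Typed

/-! ### Determinants on the oriented real frame -/

section Frame

variable {k : ℕ}

/-- The splitting of the real frame `e₁, i e₁, …, e_k, i e_k` into `e₁, …, e_k` and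
`i e₁, …, i e_k`. -/
def frameEquiv (k : ℕ) : Fin k ⊕ Fin k ≃ Fin (2 * k) where
  toFun := Sum.elim (fun a => ⟨2 * a, by omega⟩) (fun a => ⟨2 * a + 1, by omega⟩)
  invFun j := if (j : ℕ) % 2 = 0 then Sum.inl ⟨j / 2, by omega⟩ else Sum.inr ⟨j / 2, by omega⟩
  left_inv := by
    rintro (a | a)
    · simp
    · have : (2 * (a : ℕ) + 1) / 2 = a := by omega
      simp [Nat.add_mod, this]
  right_inv j := by
    by_cases h : (j : ℕ) % 2 = 0
    · simp only [h, if_true, Sum.elim_inl]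
      ext
      simp only
      omega
    · simp only [h, if_false, Sum.elim_inr]
      ext
      simp only
      omega

theorem frame_frameEquiv_inl (a : Fin k) : frame k (frameEquiv k (Sum.inl a)) = Pi.single a 1 := by
  simp [frame, frameEquiv]

theorem frame_frameEquiv_inr (a : Fin k) :
    frame k (frameEquiv k (Sum.inr a)) = Complex.I • (Pi.single a 1 : Model k) := by
  have : (2 * (a : ℕ) + 1) / 2 = a := by omega
  simp only [frame, frameEquiv, Equiv.coe_fn_mk, Sum.elim_inr, this]
  rw [← Pi.single_smul]
  simp [Nat.add_mod]

/-- The coefficient of `ℓ₁ ∧ ⋯ ∧ ℓ_k` with respect to `dz₁ ∧ ⋯ ∧ dz_k`. -/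
noncomputable def holDet (ℓ : Fin k → Model k →ₗ[ℂ] ℂ) : ℂ :=
  (Matrix.of fun i j => ℓ i (Pi.single j 1)).det

/-- The determinant factors through the real change of frame
`[[Λ, iΛ], [conj M, -i conj M]] = diag(Λ, conj M) * [[1, i], [1, -i]]`. -/
theorem det_typed_frame (ℓ m : Fin k → Model k →ₗ[ℂ] ℂ) :
    (Matrix.of fun i j : Fin k ⊕ Fin k =>
      Sum.elim (fun a => typed (ℓ a) true) (fun a => typed (m a) false) i
        (frame k (frameEquiv k j))).det =
      holDet ℓ * (starRingEnd ℂ) (holDet m) * (-2 * Complex.I) ^ k := by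
  have h : (Matrix.of fun i j : Fin k ⊕ Fin k =>
      Sum.elim (fun a => typed (ℓ a) true) (fun a => typed (m a) false) i
        (frame k (frameEquiv k j))) =
      Matrix.fromBlocks (Matrix.of fun i j => ℓ i (Pi.single j 1)) 0 0
        ((starRingEnd ℂ).mapMatrix (Matrix.of fun i j => m i (Pi.single j 1))) *
      Matrix.fromBlocks (1 : Matrix (Fin k) (Fin k) ℂ) (Complex.I • (1 : Matrix (Fin k) (Fin k) ℂ))
        (1 : Matrix (Fin k) (Fin k) ℂ) (-Complex.I • (1 : Matrix (Fin k) (Fin k) ℂ)) := by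
    rw [Matrix.fromBlocks_multiply]
    ext (i | i) (j | j)
    · simp [frame_frameEquiv_inl]
    · simp [frame_frameEquiv_inr]
    · simp [frame_frameEquiv_inl]
    · simp [frame_frameEquiv_inr]
  rw [h, Matrix.det_mul, Matrix.det_fromBlocks_zero₂₁, Matrix.det_fromBlocks_one₁₁,
    ← RingHom.map_det, holDet, holDet]
  congr 1
  rw [Matrix.one_mul, ← sub_smul, Matrix.det_smul, Matrix.det_one, Fintype.card_fin, mul_one]
  congr 1
  ring

theorem norm_det_submatrix {ι κ : Type*} [Fintype ι] [DecidableEq ι] [Fintype κ] [DecidableEq κ]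
    (M : Matrix ι ι ℂ) (e c : κ ≃ ι) : ‖(M.submatrix e c).det‖ = ‖M.det‖ := by
  have h : M.submatrix e c = (M.submatrix (c.symm.trans e) id).submatrix c c := by
    ext i j
    simp
  rw [h, Matrix.det_submatrix_equiv_self, Matrix.det_permute]
  rcases Int.units_eq_one_or (Equiv.Perm.sign (c.symm.trans e)) with h | h <;> simp [h]

end Frame

/-! ### Powers of Hermitian forms -/

section Powers

/-- The power `a ∧ ⋯ ∧ a` of a `2`-form on a real vector space. -/
noncomputable def wedgePowAt {V : Type*} [AddCommGroup V] [Module ℝ V] (a : V [⋀^Fin 2]→ₗ[ℝ] ℂ) :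
    (q : ℕ) → V [⋀^Fin (2 * q)]→ₗ[ℝ] ℂ
  | 0 => AlternatingMap.constOfIsEmpty ℝ _ (Fin 0) 1
  | q + 1 => wedgeAt (wedgePowAt a q) a

variable {V : Type*} [AddCommGroup V] [Module ℂ V] [Module ℝ V] [IsScalarTower ℝ ℂ V]

/-- The sequence `x₁, conj x₁, x₂, conj x₂, …`. -/
noncomputable def interleave {q : ℕ} (x : Fin q → V →ₗ[ℂ] ℂ) : Fin (2 * q) → V →ₗ[ℝ] ℂ :=
  fun r => typed (x ⟨r / 2, by omega⟩) (decide ((r : ℕ) % 2 = 0))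

/-- The fundamental form `(i/2) ∑ⱼ xⱼ ∧ conj xⱼ`, for linear forms `xⱼ`. -/
noncomputable def fundForm {κ : Type*} [Fintype κ] (x : κ → V →ₗ[ℂ] ℂ) : V [⋀^Fin 2]→ₗ[ℝ] ℂ :=
  MultilinearMap.alternatization
    (∑ j, (Complex.I / 2) • monomial ![typed (x j) true, typed (x j) false])

theorem fundForm_apply {κ : Type*} [Fintype κ] (x : κ → V →ₗ[ℂ] ℂ) (v w : V) :
    fundForm x ![v, w] = ∑ j, Complex.I / 2 *
      (x j v * (starRingEnd ℂ) (x j w) - x j w * (starRingEnd ℂ) (x j v)) := by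
  rw [fundForm, alternatization_sum_apply]
  refine Finset.sum_congr rfl fun j _ => ?_
  rw [alternatization_smul_apply, alternatization_monomial, Matrix.det_fin_two]
  simp

theorem interleave_append {a b : ℕ} (x : Fin a → V →ₗ[ℂ] ℂ) (y : Fin b → V →ₗ[ℂ] ℂ)
    (r : Fin (2 * a + 2 * b)) :
    Fin.append (interleave x) (interleave y) r =
      interleave (Fin.append x y) (Fin.cast (by ring) r) := by
  refine Fin.addCases (fun i => ?_) (fun i => ?_) r
  · rw [Fin.append_left]
    simp only [interleave, Fin.val_cast, Fin.val_castAdd]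
    congr 1
    rw [show (⟨(i : ℕ) / 2, by omega⟩ : Fin (a + b)) = Fin.castAdd b ⟨(i : ℕ) / 2, by omega⟩
      from rfl, Fin.append_left]
  · rw [Fin.append_right]
    simp only [interleave, Fin.val_cast, Fin.val_natAdd]
    congr 1
    · rw [show (⟨(2 * a + i : ℕ) / 2, by omega⟩ : Fin (a + b)) =
        Fin.natAdd a ⟨(i : ℕ) / 2, by omega⟩ from Fin.ext (by simp; omega), Fin.append_right]
    · simp

/-- Induction on `q`; there is no factorial because the sum runs over all maps `f`, not over
subsets. -/
theorem wedgePowAt_fundForm {κ : Type*} [Fintype κ] (x : κ → V →ₗ[ℂ] ℂ) (q : ℕ) :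
    wedgePowAt (fundForm x) q = MultilinearMap.alternatization
      (∑ f : Fin q → κ, (Complex.I / 2) ^ q • monomial (interleave (x ∘ f))) := by
  classical
  induction q with
  | zero =>
    ext v
    simp [wedgePowAt, MultilinearMap.alternatization_apply]
  | succ q ih =>
    change wedgeAt (m := 2 * q) (n := 2) (wedgePowAt (fundForm x) q) (fundForm x) = _
    rw [ih, fundForm, wedgeAt_alternatization]
    congr 1
    refine MultilinearMap.ext fun (v : Fin (2 * q + 2) → V) => ?_
    rw [mulTensor_apply]
    simp only [sum_apply, smul_apply]
    rw [Finset.sum_mul_sum, ← (Fin.snocEquiv fun _ => κ).sum_comp, Fintype.sum_prod_type,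
      Finset.sum_comm]
    refine Finset.sum_congr rfl fun j _ => Finset.sum_congr rfl fun f _ => ?_
    have h : interleave (x ∘ Fin.snoc (α := fun _ => κ) f j) =
        Fin.append (interleave (x ∘ f)) ![typed (x j) true, typed (x j) false] := by
      have h1 : ![typed (x j) true, typed (x j) false] = interleave (q := 1) ![x j] := by
        funext r
        fin_cases r <;> rfl
      have h2 : x ∘ Fin.snoc (α := fun _ => κ) f j = Fin.append (x ∘ f) ![x j] := by
        rw [Fin.append_right_eq_snoc]
        exact Fin.comp_snoc _ _ _
      rw [h1, h2]
      funext r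
      exact (interleave_append (x ∘ f) ![x j] r).symm
    have h3 := congrArg (fun m => m v) (mulTensor_monomial (n := 2) (interleave (x ∘ f))
      ![typed (x j) true, typed (x j) false])
    simp only [mulTensor_apply] at h3
    simp only [Fin.snocEquiv, Equiv.coe_fn_mk]
    rw [h, ← h3]
    simp only [smul_eq_mul]
    ring

end Powers

/-! ### The pointwise Cauchy–Schwarz inequality -/

section Pointwise

variable {k : ℕ} {κ : Type*} [Fintype κ]

/-- The sum `∑ |det|²` over all choices of `a` forms among the `x_j` and `b` forms among the `y_j`:
the density of the positive form `(∑ i/2 x_j ∧ conj x_j)^a ∧ (∑ i/2 y_j ∧ conj y_j)^b`. -/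
noncomputable def gram (x y : κ → Model k →ₗ[ℂ] ℂ) (a b : ℕ) (h : k = a + b) : ℝ :=
  ∑ f : Fin a → κ, ∑ g : Fin b → κ,
    ‖holDet fun i => Fin.append (x ∘ f) (y ∘ g) (Fin.cast h i)‖ ^ 2

theorem gram_nonneg (x y : κ → Model k →ₗ[ℂ] ℂ) (a b : ℕ) (h : k = a + b) :
    0 ≤ gram x y a b h := by
  unfold gram
  positivity

theorem holDet_le_sqrt_gram (x y : κ → Model k →ₗ[ℂ] ℂ) (a b : ℕ) (h : k = a + b)
    (f : Fin a → κ) (g : Fin b → κ) :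
    ‖holDet fun i => Fin.append (x ∘ f) (y ∘ g) (Fin.cast h i)‖ ≤ √(gram x y a b h) := by
  refine Real.le_sqrt_of_sq_le ?_
  unfold gram
  refine le_trans ?_ (Finset.single_le_sum (fun f _ => ?_) (Finset.mem_univ f))
  · exact Finset.single_le_sum (f := fun g =>
      ‖holDet fun i => Fin.append (x ∘ f) (y ∘ g) (Fin.cast h i)‖ ^ 2) (fun g _ => by positivity)
      (Finset.mem_univ g)
  · positivity

/-- Interchanging the two families permutes the rows of the determinants. This is what turns the
estimate for pullbacks into the one for direct images. -/
theorem gram_comm (x y : κ → Model k →ₗ[ℂ] ℂ) (a b : ℕ) (h : k = a + b) (h' : k = b + a) :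
    gram x y a b h = gram y x b a h' := by
  unfold gram
  rw [Finset.sum_comm]
  refine Finset.sum_congr rfl fun g _ => Finset.sum_congr rfl fun f _ => ?_
  congr 1
  have : (Matrix.of fun i j => Fin.append (y ∘ g) (x ∘ f) (Fin.cast h' i)
      (Pi.single j 1 : Model k)) =
      (Matrix.of fun i j => Fin.append (x ∘ f) (y ∘ g) (Fin.cast h i)
      (Pi.single j 1 : Model k)).submatrix
        ((finCongr h').trans (finAddFlip.trans (finCongr h.symm))) (Equiv.refl _) := by
    ext i j
    simp only [Matrix.of_apply, Matrix.submatrix_apply, Equiv.trans_apply, finCongr_apply]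
    obtain ⟨i, rfl⟩ : ∃ i', i = Fin.cast h'.symm i' := ⟨Fin.cast h' i, by simp⟩
    refine Fin.addCases (fun i => ?_) (fun i => ?_) i <;> simp
  rw [holDet, holDet, this, norm_det_submatrix]

/-- The density of `η₂^a ∧ η₁^b`, for fundamental forms `η₂`, `η₁`, with respect to the complex
orientation. -/
theorem wedgeAt_wedgePowAt_frame (x y : κ → Model k →ₗ[ℂ] ℂ) {a b : ℕ} (h : k = a + b)
    (hn : 2 * a + 2 * b = 2 * k) :
    wedgeAt (wedgePowAt (fundForm x) a) (wedgePowAt (fundForm y) b)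
      (fun j => frame k (Fin.cast hn j)) = (gram x y a b h : ℂ) := by
  classical
  rw [wedgePowAt_fundForm, wedgePowAt_fundForm, wedgeAt_alternatization]
  have hI : (Complex.I / 2) ^ k = (Complex.I / 2) ^ a * (Complex.I / 2) ^ b := by
    rw [h, pow_add]
  have h1 : mulTensor
      (∑ f : Fin a → κ, (Complex.I / 2) ^ a • monomial (interleave (x ∘ f)))
      (∑ g : Fin b → κ, (Complex.I / 2) ^ b • monomial (interleave (y ∘ g))) =
      ∑ f : Fin a → κ, ∑ g : Fin b → κ, (Complex.I / 2) ^ k •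
        monomial (Fin.append (interleave (x ∘ f)) (interleave (y ∘ g))) := by
    refine MultilinearMap.ext fun v => ?_
    simp only [mulTensor_apply, sum_apply, smul_apply,
      ← mulTensor_monomial, smul_eq_mul, Finset.sum_mul_sum]
    refine Finset.sum_congr rfl fun f _ => Finset.sum_congr rfl fun g _ => ?_
    rw [hI]
    ring
  rw [h1]
  simp only [alternatization_sum_apply, gram]
  push_cast
  refine Finset.sum_congr rfl fun f _ => Finset.sum_congr rfl fun g _ => ?_
  rw [alternatization_smul_apply, alternatization_monomial,
    ← Matrix.det_submatrix_equiv_self ((frameEquiv k).trans (finCongr hn.symm))]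
  have h2 : (Matrix.of fun i j => Fin.append (interleave (x ∘ f)) (interleave (y ∘ g)) i
      (frame k (Fin.cast hn j))).submatrix ((frameEquiv k).trans (finCongr hn.symm))
        ((frameEquiv k).trans (finCongr hn.symm)) =
      Matrix.of fun i j : Fin k ⊕ Fin k =>
        Sum.elim (fun i => typed (Fin.append (x ∘ f) (y ∘ g) (Fin.cast h i)) true)
          (fun i => typed (Fin.append (x ∘ f) (y ∘ g) (Fin.cast h i)) false) i
          (frame k (frameEquiv k j)) := by
    ext i j
    simp only [Matrix.of_apply, Matrix.submatrix_apply, Equiv.trans_apply, finCongr_apply,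
      interleave_append]
    congr 1
    rcases i with i | i
    · simp only [interleave, frameEquiv, Equiv.coe_fn_mk, Sum.elim_inl, Fin.val_cast]
      congr 2
      · ext
        simp
      · simp
    · simp only [interleave, frameEquiv, Equiv.coe_fn_mk, Sum.elim_inr, Fin.val_cast]
      congr 2
      · ext
        simp
        omega
      · simp [Nat.add_mod]
  rw [h2, det_typed_frame (fun i => Fin.append (x ∘ f) (y ∘ g) (Fin.cast h i))
    (fun i => Fin.append (x ∘ f) (y ∘ g) (Fin.cast h i)), Complex.mul_conj',
    mul_comm, mul_assoc, ← mul_pow]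
  have h3 : -2 * Complex.I * (Complex.I / 2) = 1 := by
    linear_combination -Complex.I_mul_I
  rw [h3, one_pow, mul_one]

/-- The form `α` is a combination, with coefficients bounded by `R`, of products of `p` of the
linear forms `x_j` and of `n - p` of their conjugates. -/
def HasExpansion {V : Type*} [AddCommGroup V] [Module ℂ V] [Module ℝ V] [IsScalarTower ℝ ℂ V]
    (x : κ → V →ₗ[ℂ] ℂ) (p : ℕ) (R : ℝ) {n : ℕ} (α : V [⋀^Fin n]→ₗ[ℝ] ℂ) : Prop :=
  ∃ A : (Fin n → κ × Bool) → ℂ, (∀ σ, ‖A σ‖ ≤ R) ∧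
    (∀ σ, A σ ≠ 0 → Fintype.card {i // (σ i).2 = true} = p) ∧
    ∀ v, α v = ∑ σ, A σ * ∏ i, typed (x (σ i).1) (σ i).2 (v i)

theorem HasExpansion.compLinearMap {V W : Type*} [AddCommGroup V] [Module ℂ V] [Module ℝ V]
    [IsScalarTower ℝ ℂ V] [AddCommGroup W] [Module ℂ W] [Module ℝ W] [IsScalarTower ℝ ℂ W]
    {x : κ → W →ₗ[ℂ] ℂ} {p : ℕ} {R : ℝ} {n : ℕ} {α : W [⋀^Fin n]→ₗ[ℝ] ℂ}
    (h : HasExpansion x p R α) (L : V →ₗ[ℂ] W) :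
    HasExpansion (fun j => (x j).comp L) p R (α.compLinearMap (L.restrictScalars ℝ)) := by
  obtain ⟨A, h1, h2, h3⟩ := h
  refine ⟨A, h1, h2, fun v => ?_⟩
  rw [AlternatingMap.compLinearMap_apply, h3]
  refine Finset.sum_congr rfl fun σ _ => ?_
  congr 1
  refine Finset.prod_congr rfl fun i _ => ?_
  cases (σ i).2 <;> rfl

theorem fundForm_compLinearMap {V W : Type*} [AddCommGroup V] [Module ℂ V] [Module ℝ V]
    [IsScalarTower ℝ ℂ V] [AddCommGroup W] [Module ℂ W] [Module ℝ W] [IsScalarTower ℝ ℂ W]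
    (x : κ → W →ₗ[ℂ] ℂ) (L : V →ₗ[ℂ] W) :
    (fundForm x).compLinearMap (L.restrictScalars ℝ) = fundForm fun j => (x j).comp L := by
  ext v
  obtain ⟨a, b, rfl⟩ : ∃ a b, v = ![a, b] := ⟨v 0, v 1, by ext i; fin_cases i <;> rfl⟩
  have : (fun i => (L.restrictScalars ℝ) (![a, b] i)) = ![L a, L b] := by
    ext i
    fin_cases i <;> rfl
  rw [AlternatingMap.compLinearMap_apply, this, fundForm_apply, fundForm_apply]
  rfl

/-- A product of `p` of the `x_j`, `q` conjugates of them, `p'` of the `y_j` and `q'` conjugates of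
them, in any order: sorting the holomorphic factors from the others splits the determinant. -/
theorem norm_det_append_le (x y : κ → Model k →ₗ[ℂ] ℂ) {p q p' q' : ℕ} (hp : k = p + p')
    (hq : k = q + q') {n n' : ℕ} (hn : n = p + q) (hn' : n' = p' + q') (hk : n + n' = 2 * k)
    (σ : Fin n → κ × Bool) (τ : Fin n' → κ × Bool)
    (hσ : Fintype.card {i // (σ i).2 = true} = p)
    (hτ : Fintype.card {i // (τ i).2 = true} = p') :
    ‖(Matrix.of fun i j => Fin.append (fun i => typed (x (σ i).1) (σ i).2)
        (fun i => typed (y (τ i).1) (τ i).2) i (frame k (Fin.cast hk j))).det‖ ≤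
      √(gram x y p p' hp) * √(gram x y q q' hq) * 2 ^ k := by
  classical
  have hσ' : Fintype.card {i // ¬ (σ i).2 = true} = q := by
    rw [Fintype.card_subtype_compl, hσ, Fintype.card_fin]
    omega
  have hτ' : Fintype.card {i // ¬ (τ i).2 = true} = q' := by
    rw [Fintype.card_subtype_compl, hτ, Fintype.card_fin]
    omega
  let e₁ := (Fintype.equivFinOfCardEq hσ).symm
  let e₂ := (Fintype.equivFinOfCardEq hσ').symm
  let e₃ := (Fintype.equivFinOfCardEq hτ).symm
  let e₄ := (Fintype.equivFinOfCardEq hτ').symm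
  let eσ : Fin p ⊕ Fin q ≃ Fin n :=
    (Equiv.sumCongr e₁ e₂).trans (Equiv.sumCompl fun i => (σ i).2 = true)
  let eτ : Fin p' ⊕ Fin q' ≃ Fin n' :=
    (Equiv.sumCongr e₃ e₄).trans (Equiv.sumCompl fun i => (τ i).2 = true)
  let e : Fin k ⊕ Fin k ≃ Fin (n + n') :=
    (Equiv.sumCongr ((finCongr hp).trans finSumFinEquiv.symm)
      ((finCongr hq).trans finSumFinEquiv.symm)).trans
    ((Equiv.sumSumSumComm (Fin p) (Fin p') (Fin q) (Fin q')).trans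
      ((Equiv.sumCongr eσ eτ).trans finSumFinEquiv))
  rw [← norm_det_submatrix _ e ((frameEquiv k).trans (finCongr hk.symm))]
  have h : (Matrix.of fun i j => Fin.append (fun i => typed (x (σ i).1) (σ i).2)
        (fun i => typed (y (τ i).1) (τ i).2) i (frame k (Fin.cast hk j))).submatrix e
          ((frameEquiv k).trans (finCongr hk.symm)) =
      Matrix.of fun i j : Fin k ⊕ Fin k => Sum.elim
        (fun i => typed (Fin.append (x ∘ fun i => (σ (e₁ i)).1) (y ∘ fun i => (τ (e₃ i)).1)
          (Fin.cast hp i)) true)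
        (fun i => typed (Fin.append (x ∘ fun i => (σ (e₂ i)).1) (y ∘ fun i => (τ (e₄ i)).1)
          (Fin.cast hq i)) false) i
          (frame k (frameEquiv k j)) := by
    ext i j
    simp only [Matrix.of_apply, Matrix.submatrix_apply, Equiv.trans_apply, finCongr_apply]
    congr 1
    rcases i with i | i
    · obtain ⟨i, rfl⟩ : ∃ i', i = Fin.cast hp.symm i' := ⟨Fin.cast hp i, by simp⟩
      refine Fin.addCases (fun i => ?_) (fun i => ?_) i
      · have := (e₁ i).2
        simp [e, eσ, this]
      · have := (e₃ i).2
        simp [e, eτ, this]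
    · obtain ⟨i, rfl⟩ : ∃ i', i = Fin.cast hq.symm i' := ⟨Fin.cast hq i, by simp⟩
      refine Fin.addCases (fun i => ?_) (fun i => ?_) i
      · have := (e₂ i).2
        simp only [Bool.not_eq_true] at this
        simp [e, eσ, this]
      · have := (e₄ i).2
        simp only [Bool.not_eq_true] at this
        simp [e, eτ, this]
  rw [h, det_typed_frame (fun i => Fin.append (x ∘ fun i => (σ (e₁ i)).1)
      (y ∘ fun i => (τ (e₃ i)).1) (Fin.cast hp i))
    (fun i => Fin.append (x ∘ fun i => (σ (e₂ i)).1) (y ∘ fun i => (τ (e₄ i)).1) (Fin.cast hq i)),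
    norm_mul, norm_mul, norm_pow, norm_mul, Complex.norm_I, RCLike.norm_conj]
  have h2 : ‖(-2 : ℂ)‖ * 1 = 2 := by simp
  rw [h2]
  gcongr
  · exact holDet_le_sqrt_gram _ _ _ _ _ _ _
  · exact holDet_le_sqrt_gram _ _ _ _ _ _ _

/-- Pointwise Cauchy–Schwarz inequality for a form of bidegree `(p, q)` in the `x_j` and a form of
complementary bidegree `(p', q')` in the `y_j`. -/
theorem norm_wedgeAt_frame_le (x y : κ → Model k →ₗ[ℂ] ℂ) {p q p' q' : ℕ} (hp : k = p + p')
    (hq : k = q + q') {n n' : ℕ} (hn : n = p + q) (hn' : n' = p' + q') (hk : n + n' = 2 * k)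
    {R R' : ℝ} (hR : 0 ≤ R) (hR' : 0 ≤ R')
    {α : Model k [⋀^Fin n]→ₗ[ℝ] ℂ} {β : Model k [⋀^Fin n']→ₗ[ℝ] ℂ}
    (hα : HasExpansion x p R α) (hβ : HasExpansion y p' R' β) :
    ‖wedgeAt α β (fun j => frame k (Fin.cast hk j))‖ ≤
      (Fintype.card (Fin n → κ × Bool) * Fintype.card (Fin n' → κ × Bool) * (R * R') * 2 ^ k) *
        (√(gram x y p p' hp) * √(gram x y q q' hq)) := by
  classical
  obtain ⟨A, hA, hAp, hαA⟩ := hα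
  obtain ⟨B, hB, hBp, hβB⟩ := hβ
  rw [eq_alternatization α, eq_alternatization β, wedgeAt_alternatization]
  have h1 : mulTensor (((n.factorial : ℂ)⁻¹) • (α : MultilinearMap ℝ (fun _ : Fin n => Model k) ℂ))
      (((n'.factorial : ℂ)⁻¹) • (β : MultilinearMap ℝ (fun _ : Fin n' => Model k) ℂ)) =
      ((n.factorial : ℂ)⁻¹ * (n'.factorial : ℂ)⁻¹) • ∑ σ, ∑ τ, (A σ * B τ) •
        monomial (Fin.append (fun i => typed (x (σ i).1) (σ i).2)
          (fun i => typed (y (τ i).1) (τ i).2)) := by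
    refine MultilinearMap.ext fun v => ?_
    simp only [mulTensor_apply, sum_apply, smul_apply,
      ← mulTensor_monomial, smul_eq_mul, AlternatingMap.coe_multilinearMap, hαA, hβB,
      monomial_apply]
    rw [mul_mul_mul_comm, Finset.sum_mul_sum]
    congr 1
    refine Finset.sum_congr rfl fun f _ => Finset.sum_congr rfl fun g _ => ?_
    ring
  rw [h1, alternatization_smul_apply, norm_mul]
  simp only [alternatization_sum_apply]
  have hfac : ∀ m : ℕ, ‖(m.factorial : ℂ)⁻¹‖ ≤ 1 := by
    intro m
    rw [norm_inv, Complex.norm_natCast]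
    exact inv_le_one_of_one_le₀ (by exact_mod_cast m.factorial_pos)
  have h2 : ‖(n.factorial : ℂ)⁻¹ * (n'.factorial : ℂ)⁻¹‖ ≤ 1 := by
    rw [norm_mul]
    exact mul_le_one₀ (hfac n) (norm_nonneg _) (hfac n')
  refine (mul_le_of_le_one_left (norm_nonneg _) h2).trans ?_
  set D := √(gram x y p p' hp) * √(gram x y q q' hq) with hD
  have hD0 : 0 ≤ D := by positivity
  have h3 : ∀ σ τ, ‖MultilinearMap.alternatization ((A σ * B τ) •
        monomial (Fin.append (fun i => typed (x (σ i).1) (σ i).2)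
          (fun i => typed (y (τ i).1) (τ i).2))) (fun j => frame k (Fin.cast hk j))‖ ≤
      R * R' * (D * 2 ^ k) := by
    intro σ τ
    rw [alternatization_smul_apply, norm_mul, norm_mul]
    by_cases hσ : A σ = 0
    · rw [hσ, norm_zero, zero_mul, zero_mul]
      positivity
    by_cases hτ : B τ = 0
    · rw [hτ, norm_zero, mul_zero, zero_mul]
      positivity
    rw [alternatization_monomial]
    gcongr
    · exact hA σ
    · exact hB τ
    · exact norm_det_append_le x y hp hq hn hn' hk σ τ (hAp σ hσ) (hBp τ hτ)
  calc _ ≤ ∑ σ : Fin n → κ × Bool, ∑ τ : Fin n' → κ × Bool, R * R' * (D * 2 ^ k) := by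
        refine (norm_sum_le _ _).trans (Finset.sum_le_sum fun σ _ => ?_)
        exact (norm_sum_le _ _).trans (Finset.sum_le_sum fun τ _ => h3 σ τ)
    _ = _ := by
        simp only [Finset.sum_const, Finset.card_univ, nsmul_eq_mul]
        ring

end Pointwise

/-! ### Unitary coordinates -/

section Unitary

variable {V : Type*} [AddCommGroup V] [Module ℂ V] [Module ℝ V] [IsScalarTower ℝ ℂ V]

/-- A positive real `(1, 1)`-form on a vector space is `(i/2) ∑ⱼ zⱼ ∧ conj zⱼ` in suitable linear
coordinates: those of an orthonormal basis for the Hermitian inner product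
`⟪v, w⟫ = η(v, i w) + i η(v, w)`. -/
theorem exists_basis_eq_fundForm [FiniteDimensional ℂ V] {k : ℕ} (hk : Module.finrank ℂ V = k)
    (η : V [⋀^Fin 2]→ₗ[ℝ] ℂ)
    (hbi : ∀ (c : ℂ) v, η (fun i => c • v i) = c ^ 1 * (starRingEnd ℂ) c ^ 1 * η v)
    (hreal : ∀ v, (η v).im = 0) (hpos : ∀ v, v ≠ 0 → 0 < (η ![v, Complex.I • v]).re) :
    ∃ b : Module.Basis (Fin k) ℂ V, η = fundForm fun j => b.coord j := by
  subst hk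
  let r : V → V → ℝ := fun v w => (η ![v, w]).re
  have hη : ∀ v w, η ![v, w] = r v w := fun v w => Complex.ext rfl (by simpa using hreal _)
  have hadd : ∀ u v w, r (u + v) w = r u w + r v w := by
    intro u v w
    have := η.map_vecCons_add (m := ![w]) u v
    exact (congrArg Complex.re this).trans (Complex.add_re _ _)
  have hsmul : ∀ (a : ℝ) v w, r (a • v) w = a * r v w := by
    intro a v w
    have := η.map_vecCons_smul (m := ![w]) a v
    refine (congrArg Complex.re this).trans ?_
    simp [r]
  have hanti : ∀ v w, r v w = - r w v := by
    intro v w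
    have := η.map_swap ![w, v] (i := 0) (j := 1) (by simp)
    have h2 : ![w, v] ∘ Equiv.swap (0 : Fin 2) 1 = ![v, w] := by
      ext i
      fin_cases i <;> simp
    rw [h2] at this
    simp [r, this]
  have hI : ∀ v w, r (Complex.I • v) (Complex.I • w) = r v w := by
    intro v w
    have := hbi Complex.I ![v, w]
    have h2 : (fun i => Complex.I • ![v, w] i) = ![Complex.I • v, Complex.I • w] := by
      ext i
      fin_cases i <;> simp
    rw [h2] at this
    simp only [r, this]
    simp
  have hneg : ∀ v w, r (-v) w = - r v w := by
    intro v w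
    have := hsmul (-1) v w
    simpa using this
  have hI2 : ∀ v w, r (Complex.I • v) w = - r v (Complex.I • w) := by
    intro v w
    rw [← hI, smul_smul, Complex.I_mul_I, neg_one_smul, hneg]
  have hcsmul : ∀ (c : ℂ) v w, r (c • v) w = c.re * r v w + c.im * r (Complex.I • v) w := by
    intro c v w
    have : c • v = c.re • v + c.im • (Complex.I • v) := by
      rw [← algebraMap_smul ℂ c.re v, ← algebraMap_smul ℂ c.im (Complex.I • v), smul_smul,
        ← add_smul]
      simp [Complex.re_add_im]
    rw [this, hadd, hsmul, hsmul]
  let core : InnerProductSpace.Core ℂ V :=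
    { inner := fun v w => ⟨r v (Complex.I • w), r v w⟩
      conj_inner_symm := by
        intro v w
        apply Complex.ext
        · simp only [Complex.conj_re]
          rw [hanti, hI2, neg_neg]
        · simp only [Complex.conj_im]
          rw [hanti, neg_neg]
      re_inner_nonneg := by
        intro v
        by_cases h : v = 0
        · subst h
          have := hsmul 0 0 (Complex.I • (0 : V))
          simp only [zero_smul, zero_mul] at this
          exact this.ge
        · exact (hpos v h).le
      add_left := by
        intro u v w
        apply Complex.ext <;> simp [hadd]
      smul_left := by
        intro v w c
        apply Complex.ext
        · simp only [Complex.mul_re, Complex.conj_re, Complex.conj_im]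
          rw [hcsmul, hI]
          ring
        · simp only [Complex.mul_im, Complex.conj_re, Complex.conj_im]
          rw [hcsmul, hI2]
          ring
      definite := by
        intro v h
        by_contra h0
        exact (hpos v h0).ne' (congrArg Complex.re h) }
  let _ : NormedAddCommGroup V := core.toNormedAddCommGroup
  let _ : InnerProductSpace ℂ V := InnerProductSpace.ofCore core.toCore
  let b := stdOrthonormalBasis ℂ V
  refine ⟨b.toBasis, ?_⟩
  ext v
  obtain ⟨x, y, rfl⟩ : ∃ x y, v = ![x, y] := ⟨v 0, v 1, by ext i; fin_cases i <;> rfl⟩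
  have h1 : ∀ (j) (w : V), b.toBasis.coord j w = inner ℂ (b j) w := by
    intro j w
    simp [b.repr_apply_apply]
  have h2 := b.sum_inner_mul_inner x y
  have h3 : (inner ℂ x y : ℂ).im = r x y := rfl
  rw [hη, ← h3, ← h2, fundForm_apply, Complex.im_sum, Complex.ofReal_sum]
  refine Finset.sum_congr rfl fun j _ => ?_
  rw [h1, h1, inner_conj_symm, inner_conj_symm]
  have h4 : (inner ℂ (b j) x * inner ℂ y (b j) : ℂ) =
      (starRingEnd ℂ) (inner ℂ x (b j) * inner ℂ (b j) y) := by
    rw [map_mul, inner_conj_symm, inner_conj_symm]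
  rw [h4, mul_comm (inner ℂ (b j) y : ℂ)]
  generalize (inner ℂ x (b j) * inner ℂ (b j) y : ℂ) = z
  apply Complex.ext
  · simp
    ring
  · simp

theorem fundForm_self {κ : Type*} [Fintype κ] (x : κ → V →ₗ[ℂ] ℂ) (v : V) :
    (fundForm x ![v, Complex.I • v]).re = ∑ j, ‖x j v‖ ^ 2 := by
  rw [fundForm_apply, Complex.re_sum]
  refine Finset.sum_congr rfl fun j _ => ?_
  rw [map_smul, ← Complex.normSq_eq_norm_sq, Complex.normSq_apply]
  generalize x j v = z
  simp
  ring

/-- The vectors `b j` and `i b j` have length `1`, so a bound on unit vectors bounds the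
coefficients. -/
theorem hasExpansion_of_bounded {κ : Type*} [Fintype κ] [DecidableEq κ]
    (b : Module.Basis κ ℂ V) {p q : ℕ}
    (α : V [⋀^Fin (p + q)]→ₗ[ℝ] ℂ) {R : ℝ} (hR0 : 0 ≤ R)
    (hα : ∀ (c : ℂ) v, α (fun i => c • v i) = c ^ p * (starRingEnd ℂ) c ^ q * α v)
    (hR : ∀ v : Fin (p + q) → V,
      (∀ i, (fundForm (fun j => b.coord j) ![v i, Complex.I • v i]).re ≤ 1) → ‖α v‖ ≤ R) :
    HasExpansion (fun j => b.coord j) p R α := by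
  have key : ∀ j, ∑ i, ‖b.coord i (b j)‖ ^ 2 = 1 := by
    intro j
    rw [Finset.sum_eq_single j]
    · simp
    · intro i _ hi
      simp [hi.symm]
    · simp
  refine exists_bidegree_expansion b α hR0 hα fun v hv => hR v fun i => ?_
  rw [fundForm_self]
  obtain ⟨j, h | h⟩ := hv i
  · rw [h, key]
  · rw [h, ← key j]
    simp

end Unitary

/-! ### Exterior products and linear maps -/

theorem alternatization_compLinearMap {V W : Type*} [AddCommGroup V] [Module ℝ V]
    [AddCommGroup W] [Module ℝ W] {n : ℕ} (m : MultilinearMap ℝ (fun _ : Fin n => W) ℂ)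
    (L : V →ₗ[ℝ] W) :
    (MultilinearMap.alternatization m).compLinearMap L =
      MultilinearMap.alternatization (m.compLinearMap fun _ => L) := by
  ext v
  simp [MultilinearMap.alternatization_apply]

theorem wedgeAt_compLinearMap {V W : Type*} [AddCommGroup V] [Module ℝ V]
    [AddCommGroup W] [Module ℝ W] {m n : ℕ} (a : W [⋀^Fin m]→ₗ[ℝ] ℂ) (b : W [⋀^Fin n]→ₗ[ℝ] ℂ)
    (L : V →ₗ[ℝ] W) :
    (wedgeAt a b).compLinearMap L = wedgeAt (a.compLinearMap L) (b.compLinearMap L) := by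
  rw [eq_alternatization a, eq_alternatization b, wedgeAt_alternatization,
    alternatization_compLinearMap, alternatization_compLinearMap, alternatization_compLinearMap,
    wedgeAt_alternatization]
  congr 1

theorem wedgePowAt_compLinearMap {V W : Type*} [AddCommGroup V] [Module ℝ V]
    [AddCommGroup W] [Module ℝ W] (a : W [⋀^Fin 2]→ₗ[ℝ] ℂ) (L : V →ₗ[ℝ] W) (q : ℕ) :
    (wedgePowAt a q).compLinearMap L = wedgePowAt (a.compLinearMap L) q := by
  induction q with
  | zero => rfl
  | succ q ih =>
    change (wedgeAt (m := 2 * q) (n := 2) (wedgePowAt a q) a).compLinearMap L =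
      wedgeAt (m := 2 * q) (n := 2) (wedgePowAt (a.compLinearMap L) q) (a.compLinearMap L)
    rw [wedgeAt_compLinearMap, ih]

theorem wedgePow_apply {k : ℕ} {X : Type*} [TopologicalSpace X] [ChartedSpace (Model k) X]
    (η : DForm 𝓘(ℂ, Model k) X 2) (q : ℕ) (x : X) : wedgePow η q x = wedgePowAt (η x) q := by
  induction q with
  | zero => rfl
  | succ q ih =>
    change wedgeAt (m := 2 * q) (n := 2) (wedgePow η q x) (η x) = _
    rw [ih]
    rfl

/-! ### Continuity of exterior products -/

section Continuity

variable {T : Type*} {l : Filter T} {E : Type*} [NormedAddCommGroup E] [NormedSpace ℝ E]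

/-- On a finite-dimensional space, pointwise convergence of alternating forms implies joint
convergence of the values. -/
theorem tendsto_apply_of_forall [FiniteDimensional ℝ E] {n : ℕ} {φ : T → E [⋀^Fin n]→ₗ[ℝ] ℂ}
    {φ₀ : E [⋀^Fin n]→ₗ[ℝ] ℂ} (h : ∀ v, Tendsto (fun t => φ t v) l (𝓝 (φ₀ v)))
    {w : T → Fin n → E} {w₀ : Fin n → E} (hw : Tendsto w l (𝓝 w₀)) :
    Tendsto (fun t => φ t (w t)) l (𝓝 (φ₀ w₀)) := by
  classical
  let B := Module.finBasis ℝ E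
  have key : ∀ (ψ : E [⋀^Fin n]→ₗ[ℝ] ℂ) (v : Fin n → E),
      ψ v = ∑ σ : Fin n → Fin (Module.finrank ℝ E),
        (∏ i, B.coord (σ i) (v i)) • ψ (fun i => B (σ i)) := by
    intro ψ v
    conv_lhs => rw [show v = fun i => ∑ t, B.coord t (v i) • B t from
      funext fun i => (B.sum_repr (v i)).symm]
    rw [← AlternatingMap.coe_multilinearMap, MultilinearMap.map_sum]
    refine Finset.sum_congr rfl fun σ _ => ?_
    rw [MultilinearMap.map_smul_univ]
  simp_rw [fun t => key (φ t) (w t), key φ₀ w₀]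
  refine tendsto_finsetSum _ fun σ _ => Tendsto.smul ?_ (h _)
  refine tendsto_finsetProd _ fun i _ => ?_
  have hc : Continuous (B.coord (σ i)) := LinearMap.continuous_of_finiteDimensional _
  exact (hc.tendsto _).comp ((tendsto_pi_nhds.1 hw) i)

theorem tendsto_wedgeAt {m n : ℕ} {a : T → E [⋀^Fin m]→ₗ[ℝ] ℂ} {a₀ : E [⋀^Fin m]→ₗ[ℝ] ℂ}
    {b : T → E [⋀^Fin n]→ₗ[ℝ] ℂ} {b₀ : E [⋀^Fin n]→ₗ[ℝ] ℂ}
    (ha : ∀ v, Tendsto (fun t => a t v) l (𝓝 (a₀ v)))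
    (hb : ∀ v, Tendsto (fun t => b t v) l (𝓝 (b₀ v))) (v : Fin (m + n) → E) :
    Tendsto (fun t => wedgeAt (a t) (b t) v) l (𝓝 (wedgeAt a₀ b₀ v)) := by
  have key : ∀ (a : E [⋀^Fin m]→ₗ[ℝ] ℂ) (b : E [⋀^Fin n]→ₗ[ℝ] ℂ), wedgeAt a b v =
      ∑ σ : Equiv.Perm (Fin (m + n)), Equiv.Perm.sign σ •
        (((m.factorial : ℂ)⁻¹ * a fun i => v (σ (Fin.castAdd n i))) *
          ((n.factorial : ℂ)⁻¹ * b fun i => v (σ (Fin.natAdd m i)))) := by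
    intro a b
    conv_lhs => rw [eq_alternatization a, eq_alternatization b, wedgeAt_alternatization,
      MultilinearMap.alternatization_apply]
    simp [mulTensor_apply]
  simp_rw [key]
  refine tendsto_finsetSum _ fun σ _ => Tendsto.const_smul ?_ _
  exact ((ha _).const_mul _).mul ((hb _).const_mul _)

theorem tendsto_wedgePowAt {a : T → E [⋀^Fin 2]→ₗ[ℝ] ℂ} {a₀ : E [⋀^Fin 2]→ₗ[ℝ] ℂ}
    (ha : ∀ v, Tendsto (fun t => a t v) l (𝓝 (a₀ v))) (q : ℕ) (v : Fin (2 * q) → E) :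
    Tendsto (fun t => wedgePowAt (a t) q v) l (𝓝 (wedgePowAt a₀ q v)) := by
  induction q with
  | zero => exact tendsto_const_nhds
  | succ q ih => exact tendsto_wedgeAt (m := 2 * q) (n := 2) ih ha v

end Continuity

/-! ### Smooth forms on a compact manifold -/

section Smooth

variable {k : ℕ} {X : Type*} [TopologicalSpace X] [ChartedSpace (Model k) X]

/-- The coefficients of a smooth form in a chart are continuous. The form in the chart is regarded
as a function with values in the alternating forms on the fixed space `ℂ^k`. -/
theorem IsSmoothForm.tendsto_chart {n : ℕ} {Φ : DForm 𝓘(ℂ, Model k) X n} (hΦ : IsSmoothForm Φ)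
    {e : OpenPartialHomeomorph X (Model k)} (he : e ∈ atlas (Model k) X) {u : Model k}
    (hu : u ∈ e.target) (v : Fin n → Model k) :
    Tendsto (fun u => (pullback 𝓘(ℂ, Model k) 𝓘(ℂ, Model k) e.symm Φ u :
      Model k [⋀^Fin n]→ₗ[ℝ] ℂ) v) (𝓝 u)
      (𝓝 ((pullback 𝓘(ℂ, Model k) 𝓘(ℂ, Model k) e.symm Φ u : Model k [⋀^Fin n]→ₗ[ℝ] ℂ) v)) :=
  ((hΦ e he v).continuousOn.continuousAt (e.open_target.mem_nhds hu)).tendsto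

variable [IsManifold 𝓘(ℂ, Model k) ω X]

theorem HermitianForm.pullback_chart_pos (η : HermitianForm k X)
    {e : OpenPartialHomeomorph X (Model k)} (he : e ∈ atlas (Model k) X) {u : Model k}
    (hu : u ∈ e.target) {w : Model k} (hw : w ≠ 0) :
    0 < ((pullback 𝓘(ℂ, Model k) 𝓘(ℂ, Model k) e.symm η.form u : Model k [⋀^Fin 2]→ₗ[ℝ] ℂ)
      ![w, Complex.I • w]).re := by
  have hI : IsManifold 𝓘(ℂ, Model k) 1 X := IsManifold.of_le (n := ω) (by simp)
  have hmd := mdifferentiable_of_mem_atlas (I := 𝓘(ℂ, Model k)) he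
  let D := mfderiv 𝓘(ℂ, Model k) 𝓘(ℂ, Model k) e.symm u
  have hinj : D w ≠ 0 := by
    intro h
    have h2 := congrArg (fun A => A w) (hmd.comp_symm_deriv hu)
    have h3 : mfderiv 𝓘(ℂ, Model k) 𝓘(ℂ, Model k) e (e.symm u) (D w) = w := h2
    rw [h, map_zero] at h3
    exact hw h3.symm
  have h := η.pos (e.symm u) (D w) hinj
  rw [show Complex.I • D w = D (Complex.I • w) from (D.map_smul Complex.I w).symm] at h
  have hfun : (fun i => D ((![w, Complex.I • w] : Fin 2 → Model k) i)) =
      ![D w, D (Complex.I • w)] := by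
    funext i
    fin_cases i <;> rfl
  rw [← hfun] at h
  exact h

/-- Near a point of a chart, the vectors of norm at most `1` for a Hermitian metric are bounded. -/
theorem HermitianForm.eventually_norm_le (η : HermitianForm k X)
    {e : OpenPartialHomeomorph X (Model k)} (he : e ∈ atlas (Model k) X) {u₀ : Model k}
    (hu : u₀ ∈ e.target) :
    ∃ ρ : ℝ, 0 ≤ ρ ∧ ∀ᶠ u in 𝓝 u₀, ∀ w : Model k,
      ((pullback 𝓘(ℂ, Model k) 𝓘(ℂ, Model k) e.symm η.form u : Model k [⋀^Fin 2]→ₗ[ℝ] ℂ)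
        ![w, Complex.I • w]).re ≤ 1 → ‖w‖ ≤ ρ := by
  let φ : Model k → Model k [⋀^Fin 2]→ₗ[ℝ] ℂ := fun u =>
    pullback 𝓘(ℂ, Model k) 𝓘(ℂ, Model k) e.symm η.form u
  have hpair : Continuous fun w : Model k => ![w, Complex.I • w] := by
    refine continuous_pi fun i => ?_
    fin_cases i
    · exact continuous_id
    · exact continuous_const_smul Complex.I
  have hK : IsCompact (Metric.sphere (0 : Model k) 1) := isCompact_sphere 0 1
  have hcont : ∀ u ∈ e.target, ∀ w, Tendsto (fun z : Model k × Model k =>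
      (φ z.1 ![z.2, Complex.I • z.2]).re) (𝓝 (u, w)) (𝓝 (φ u ![w, Complex.I • w]).re) := by
    intro u hu w
    refine (Complex.continuous_re.tendsto _).comp ?_
    refine tendsto_apply_of_forall (φ := fun z : Model k × Model k => φ z.1) (fun v => ?_)
      ((hpair.tendsto w).comp continuous_snd.continuousAt)
    exact (η.smooth.tendsto_chart he hu v).comp continuous_fst.continuousAt
  have hcont₀ : ∀ w, ContinuousAt (fun w => (φ u₀ ![w, Complex.I • w]).re) w := fun w =>
    (Complex.continuous_re.tendsto _).comp (tendsto_apply_of_forall (φ := fun _ : Model k => φ u₀)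
      (fun v => tendsto_const_nhds) (hpair.tendsto w))
  obtain ⟨c, hc0, hc⟩ := hK.exists_forall_le' (f := fun w => (φ u₀ ![w, Complex.I • w]).re)
    (a := 0) (fun w _ => (hcont₀ w).continuousWithinAt)
    (fun w hw => η.pullback_chart_pos he hu (by
      rintro rfl
      simp at hw))
  have hev : ∀ᶠ u in 𝓝 u₀, ∀ w ∈ Metric.sphere (0 : Model k) 1,
      c / 2 < (φ u ![w, Complex.I • w]).re := by
    refine hK.eventually_forall_of_forall_eventually fun w hw => ?_
    exact (hcont u₀ hu w).eventually_const_lt (lt_of_lt_of_le (by linarith) (hc w hw))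
  refine ⟨√(2 / c), Real.sqrt_nonneg _, hev.mono fun u hu w hw => ?_⟩
  by_cases hw0 : w = 0
  · rw [hw0, norm_zero]
    positivity
  have hn : 0 < ‖w‖ := norm_pos_iff.2 hw0
  have h1 := hu (‖w‖⁻¹ • w) (by
    rw [mem_sphere_zero_iff_norm, norm_smul, norm_inv, norm_norm, inv_mul_cancel₀ hn.ne'])
  have h2 : ![‖w‖⁻¹ • w, Complex.I • ‖w‖⁻¹ • w] = fun i => ‖w‖⁻¹ • ![w, Complex.I • w] i := by
    funext i
    fin_cases i
    · rfl
    · exact smul_comm _ _ _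
  rw [h2, AlternatingMap.map_smul_univ] at h1
  simp only [Finset.prod_const, Finset.card_univ, Fintype.card_fin, Complex.real_smul,
    Complex.re_ofReal_mul] at h1
  have h3 : c / 2 < ‖w‖⁻¹ ^ 2 := by
    refine h1.trans_le (mul_le_of_le_one_right (by positivity) hw)
  refine Real.le_sqrt_of_sq_le ?_
  rw [inv_pow, lt_inv_comm₀ (by positivity) (by positivity)] at h3
  refine h3.le.trans (le_of_eq ?_)
  rw [inv_div]

/-- A smooth form on a compact manifold is bounded with respect to any Hermitian metric. -/
theorem IsSmoothForm.exists_bound [CompactSpace X] (η : HermitianForm k X) {n : ℕ}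
    {Φ : DForm 𝓘(ℂ, Model k) X n} (hΦ : IsSmoothForm Φ) :
    ∃ R : ℝ, 0 ≤ R ∧ ∀ (x : X) (v : Fin n → TangentSpace 𝓘(ℂ, Model k) x),
      (∀ i, (η.form x ![v i, Complex.I • v i]).re ≤ 1) → ‖Φ x v‖ ≤ R := by
  have hI : IsManifold 𝓘(ℂ, Model k) 1 X := IsManifold.of_le (n := ω) (by simp)
  have hloc : ∀ x₀ : X, ∃ R : ℝ, ∀ᶠ x in 𝓝 x₀,
      ∀ v : Fin n → TangentSpace 𝓘(ℂ, Model k) x,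
      (∀ i, (η.form x ![v i, Complex.I • v i]).re ≤ 1) → ‖Φ x v‖ ≤ R := by
    intro x₀
    set e := chartAt (Model k) x₀ with he_def
    have he : e ∈ atlas (Model k) X := chart_mem_atlas _ _
    have hx₀ : x₀ ∈ e.source := mem_chart_source _ _
    have hu₀ : e x₀ ∈ e.target := e.map_source hx₀
    have hmd := mdifferentiable_of_mem_atlas (I := 𝓘(ℂ, Model k)) he
    let φ : Model k → Model k [⋀^Fin n]→ₗ[ℝ] ℂ := fun u =>
      pullback 𝓘(ℂ, Model k) 𝓘(ℂ, Model k) e.symm Φ u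
    obtain ⟨ρ, hρ0, hρ⟩ := η.eventually_norm_le he hu₀
    have hK : IsCompact (Metric.closedBall (0 : Fin n → Model k) ρ) := isCompact_closedBall _ _
    have hcont : ∀ w, Tendsto (fun z : Model k × (Fin n → Model k) => ‖φ z.1 z.2‖)
        (𝓝 (e x₀, w)) (𝓝 ‖φ (e x₀) w‖) := by
      intro w
      refine Tendsto.norm ?_
      refine tendsto_apply_of_forall (φ := fun z : Model k × (Fin n → Model k) => φ z.1)
        (fun v => ?_) continuous_snd.continuousAt.tendsto
      exact (hΦ.tendsto_chart he hu₀ v).comp continuous_fst.continuousAt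
    have hcont₀ : ∀ w, ContinuousAt (fun w => ‖φ (e x₀) w‖) w := fun w =>
      (tendsto_apply_of_forall (φ := fun _ : Fin n → Model k => φ (e x₀))
        (fun v => tendsto_const_nhds) tendsto_id).norm
    obtain ⟨R, hR⟩ := hK.bddAbove_image (f := fun w => ‖φ (e x₀) w‖) (fun w _ =>
      (hcont₀ w).continuousWithinAt)
    have hev : ∀ᶠ u in 𝓝 (e x₀), ∀ w ∈ Metric.closedBall (0 : Fin n → Model k) ρ,
        ‖φ u w‖ < R + 1 := by
      refine hK.eventually_forall_of_forall_eventually fun w hw => ?_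
      refine (hcont w).eventually_lt_const ?_
      linarith [hR (mem_image_of_mem _ hw)]
    refine ⟨R + 1, ?_⟩
    have hce : Tendsto e (𝓝 x₀) (𝓝 (e x₀)) := e.continuousAt hx₀
    filter_upwards [hce.eventually hρ, hce.eventually hev, e.open_source.mem_nhds hx₀]
      with x h1 h2 hx v hv
    -- transport the vectors `v i` to the chart and back
    let w : Fin n → Model k := fun i => mfderiv 𝓘(ℂ, Model k) 𝓘(ℂ, Model k) e x (v i)
    have hback : ∀ y : TangentSpace 𝓘(ℂ, Model k) x,
        mfderiv 𝓘(ℂ, Model k) 𝓘(ℂ, Model k) e.symm (e x)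
          (mfderiv 𝓘(ℂ, Model k) 𝓘(ℂ, Model k) e x y) = y := fun y =>
      congrArg (fun A => A y) (hmd.symm_comp_deriv hx)
    have htr : ∀ {m : ℕ} (Ψ : DForm 𝓘(ℂ, Model k) X m) (y : Fin m → TangentSpace 𝓘(ℂ, Model k) x),
        (pullback 𝓘(ℂ, Model k) 𝓘(ℂ, Model k) e.symm Ψ (e x))
          (fun i => mfderiv 𝓘(ℂ, Model k) 𝓘(ℂ, Model k) e x (y i)) = Ψ x y := by
      intro m Ψ y
      let Ψ' : X → Model k [⋀^Fin m]→ₗ[ℝ] ℂ := Ψ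
      have : (pullback 𝓘(ℂ, Model k) 𝓘(ℂ, Model k) e.symm Ψ (e x))
          (fun i => mfderiv 𝓘(ℂ, Model k) 𝓘(ℂ, Model k) e x (y i)) =
        Ψ' (e.symm (e x)) (fun i => mfderiv 𝓘(ℂ, Model k) 𝓘(ℂ, Model k) e.symm (e x)
          (mfderiv 𝓘(ℂ, Model k) 𝓘(ℂ, Model k) e x (y i))) := rfl
      rw [this, e.left_inv hx]
      exact congrArg (Ψ' x) (funext fun i => hback (y i))
    have hw : w ∈ Metric.closedBall (0 : Fin n → Model k) ρ := by
      rw [mem_closedBall_zero_iff]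
      have hw' : ∀ i, ‖w i‖ ≤ ρ := by
        intro i
        refine h1 (w i) ?_
        have h3 := htr η.form ![v i, Complex.I • v i]
        have h4 : (fun j => mfderiv 𝓘(ℂ, Model k) 𝓘(ℂ, Model k) e x
            ((![v i, Complex.I • v i] : Fin 2 → TangentSpace 𝓘(ℂ, Model k) x) j)) =
            ![w i, Complex.I • w i] := by
          funext j
          fin_cases j
          · rfl
          · exact map_smul (mfderiv 𝓘(ℂ, Model k) 𝓘(ℂ, Model k) e x) Complex.I (v i)
        rw [h4] at h3
        exact (congrArg Complex.re h3).trans_le (hv i)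
      exact (pi_norm_le_iff_of_nonneg hρ0).2 hw'
    have h5 := h2 w hw
    have h6 : φ (e x) w = Φ x v := htr Φ v
    rw [h6] at h5
    exact h5.le
  choose R hR using hloc
  obtain ⟨t, -, ht⟩ := isCompact_univ.elim_nhds_subcover _ fun x _ => hR x
  refine ⟨∑ x ∈ t, |R x|, by positivity, fun x v hv => ?_⟩
  obtain ⟨y, hy, hxy⟩ := mem_iUnion₂.1 (ht (mem_univ x))
  exact (hxy v hv).trans ((le_abs_self _).trans
    (Finset.single_le_sum (f := fun x => |R x|) (fun _ _ => abs_nonneg _) hy))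

/-- The pullback of a smooth form under a holomorphic map `g : ℂ^k → X` has continuous
coefficients. -/
theorem IsSmoothForm.tendsto_pullback {n : ℕ} {Φ : DForm 𝓘(ℂ, Model k) X n}
    (hΦ : IsSmoothForm Φ) {g : Model k → X} {u₀ : Model k}
    (hg : ContMDiffAt 𝓘(ℂ, Model k) 𝓘(ℂ, Model k) ω g u₀) (v : Fin n → Model k) :
    Tendsto (fun u => (pullback 𝓘(ℂ, Model k) 𝓘(ℂ, Model k) g Φ u :
      Model k [⋀^Fin n]→ₗ[ℝ] ℂ) v) (𝓝 u₀)
      (𝓝 ((pullback 𝓘(ℂ, Model k) 𝓘(ℂ, Model k) g Φ u₀ : Model k [⋀^Fin n]→ₗ[ℝ] ℂ) v)) := by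
  have hI : IsManifold 𝓘(ℂ, Model k) 1 X := IsManifold.of_le (n := ω) (by simp)
  set e := chartAt (Model k) (g u₀) with he_def
  have he : e ∈ atlas (Model k) X := chart_mem_atlas _ _
  have hx₀ : g u₀ ∈ e.source := mem_chart_source _ _
  have hmd := mdifferentiable_of_mem_atlas (I := 𝓘(ℂ, Model k)) he
  let φ : Model k → Model k [⋀^Fin n]→ₗ[ℝ] ℂ := fun u =>
    pullback 𝓘(ℂ, Model k) 𝓘(ℂ, Model k) e.symm Φ u
  have hcd : ContDiffAt ℂ ω (e ∘ g) u₀ := by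
    rw [← contMDiffAt_iff_contDiffAt]
    exact ContMDiffAt.comp u₀ (contMDiffAt_of_mem_maximalAtlas
      (IsManifold.subset_maximalAtlas he) hx₀) hg
  have hfd : ContinuousAt (fderiv ℂ (e ∘ g)) u₀ :=
    (hcd.fderiv_right (m := 0) (by simp)).continuousAt
  have hev : ∀ᶠ u in 𝓝 u₀, (pullback 𝓘(ℂ, Model k) 𝓘(ℂ, Model k) g Φ u :
      Model k [⋀^Fin n]→ₗ[ℝ] ℂ) v = φ (e (g u)) fun i => fderiv ℂ (e ∘ g) u (v i) := by
    have hg1 : ∀ᶠ u in 𝓝 u₀, ContMDiffAt 𝓘(ℂ, Model k) 𝓘(ℂ, Model k) 1 g u :=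
      
      (contMDiffAt_iff_contMDiffAt_nhds (by simp)).1 (hg.of_le (by simp))
    filter_upwards [hg1, hg.continuousAt.preimage_mem_nhds (e.open_source.mem_nhds hx₀)]
      with u hu hue
    have hue' : g u ∈ e.source := hue
    let Φ' : X → Model k [⋀^Fin n]→ₗ[ℝ] ℂ := Φ
    have h1 : ∀ y : Model k, mfderiv 𝓘(ℂ, Model k) 𝓘(ℂ, Model k) e.symm (e (g u))
        (fderiv ℂ (e ∘ g) u y) = mfderiv 𝓘(ℂ, Model k) 𝓘(ℂ, Model k) g u y := by
      intro y
      have h2 : fderiv ℂ (e ∘ g) u y = mfderiv 𝓘(ℂ, Model k) 𝓘(ℂ, Model k) e (g u)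
          (mfderiv 𝓘(ℂ, Model k) 𝓘(ℂ, Model k) g u y) := by
        rw [← mfderiv_eq_fderiv, mfderiv_comp u (hmd.mdifferentiableAt hue')
          (hu.mdifferentiableAt (by simp))]
        rfl
      rw [h2]
      exact congrArg (fun A => A (mfderiv 𝓘(ℂ, Model k) 𝓘(ℂ, Model k) g u y))
        (hmd.symm_comp_deriv hue')
    have h3 : φ (e (g u)) (fun i => fderiv ℂ (e ∘ g) u (v i)) = Φ' (e.symm (e (g u)))
      (fun i => mfderiv 𝓘(ℂ, Model k) 𝓘(ℂ, Model k) e.symm (e (g u))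
        (fderiv ℂ (e ∘ g) u (v i))) := rfl
    rw [h3, e.left_inv hue']
    exact congrArg (Φ' (g u)) (funext fun i => (h1 (v i)).symm)
  have hlim : Tendsto (fun u => φ (e (g u)) fun i => fderiv ℂ (e ∘ g) u (v i)) (𝓝 u₀)
      (𝓝 (φ (e (g u₀)) fun i => fderiv ℂ (e ∘ g) u₀ (v i))) := by
    refine tendsto_apply_of_forall (φ := fun u => φ (e (g u))) (fun w => ?_) ?_
    · exact (hΦ.tendsto_chart he (e.map_source hx₀) w).comp
        ((e.continuousAt hx₀).tendsto.comp hg.continuousAt.tendsto)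
    · exact tendsto_pi_nhds.2 fun i =>
        ((ContinuousLinearMap.apply ℂ (Model k) (v i)).continuous.tendsto _).comp hfd.tendsto
  rw [hev.self_of_nhds]
  exact hlim.congr' (hev.mono fun u hu => hu.symm)

end Smooth

/-! ### Densities of forms on slice charts -/

section Density

/-- The parameter domain of a slice chart. -/
def sliceDomain {k : ℕ} {X : Type*} [TopologicalSpace X]
    (ψ : OpenPartialHomeomorph (X × X) (ModelProd (Model k) (Model k))) :
    Set (Model k) :=
  {u | ((u, 0) : ModelProd (Model k) (Model k)) ∈ ψ.target}

theorem isOpen_sliceDomain {k : ℕ} {X : Type*} [TopologicalSpace X]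
    (ψ : OpenPartialHomeomorph (X × X) (ModelProd (Model k) (Model k))) :
    IsOpen (sliceDomain ψ) :=
  ψ.open_target.preimage (Continuous.prodMk_left (0 : Model k))

variable {k : ℕ} {X : Type*} [TopologicalSpace X] [ChartedSpace (Model k) X]

theorem HermitianForm.exists_basis (η : HermitianForm k X) (x : X) :
    ∃ b : Module.Basis (Fin k) ℂ (TangentSpace 𝓘(ℂ, Model k) x),
      η.form x = fundForm fun j => b.coord j := by
  have hfin : FiniteDimensional ℂ (TangentSpace 𝓘(ℂ, Model k) x) :=
    inferInstanceAs (FiniteDimensional ℂ (Model k))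
  have hrank : Module.finrank ℂ (TangentSpace 𝓘(ℂ, Model k) x) = k := Module.finrank_fin_fun ℂ
  exact exists_basis_eq_fundForm hrank (η.form x) (fun c v => η.bidegree x c v)
    (fun v => η.real x v) (fun v hv => η.pos x v hv)

/-- A basis of the tangent space which is unitary for a Hermitian metric. -/
noncomputable def HermitianForm.basis (η : HermitianForm k X) (x : X) :
    Module.Basis (Fin k) ℂ (TangentSpace 𝓘(ℂ, Model k) x) :=
  Classical.choose (η.exists_basis x)

theorem HermitianForm.form_eq (η : HermitianForm k X) (x : X) :
    η.form x = fundForm fun j => (η.basis x).coord j :=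
  Classical.choose_spec (η.exists_basis x)

/-- The pullbacks of the unitary coordinates at `x` under a linear map into the tangent space. -/
noncomputable def HermitianForm.pullCoord (η : HermitianForm k X) {x : X}
    (L : Model k →ₗ[ℂ] TangentSpace 𝓘(ℂ, Model k) x) : Fin k → Model k →ₗ[ℂ] ℂ :=
  fun j => ((η.basis x).coord j).comp L

/-- The density of `η^a ∧ η^b`, the factors being pulled back under two linear maps. -/
theorem HermitianForm.wedgeAt_wedgePow_frame (η : HermitianForm k X) {x y : X}
    (L : Model k →ₗ[ℂ] TangentSpace 𝓘(ℂ, Model k) x)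
    (L' : Model k →ₗ[ℂ] TangentSpace 𝓘(ℂ, Model k) y) {a b : ℕ} (h : k = a + b)
    (hn : 2 * a + 2 * b = 2 * k) :
    wedgeAt ((wedgePow η.form a x).compLinearMap (L.restrictScalars ℝ))
      ((wedgePow η.form b y).compLinearMap (L'.restrictScalars ℝ))
      (fun j => frame k (Fin.cast hn j)) =
      (gram (η.pullCoord L) (η.pullCoord L') a b h : ℂ) := by
  rw [wedgePow_apply, wedgePow_apply, wedgePowAt_compLinearMap, wedgePowAt_compLinearMap,
    η.form_eq, η.form_eq, fundForm_compLinearMap, fundForm_compLinearMap]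
  exact wedgeAt_wedgePowAt_frame _ _ h hn

/-- The pointwise Cauchy–Schwarz inequality for bounded forms of complementary bidegrees, pulled
back under two linear maps. -/
theorem HermitianForm.norm_wedgeAt_frame_le (η : HermitianForm k X) {p q p' q' : ℕ}
    (hp : k = p + p') (hq : k = q + q') (hn : p + q + (p' + q') = 2 * k)
    {Φ : DForm 𝓘(ℂ, Model k) X (p + q)} (hΦ : IsBidegree p q Φ)
    {Ψ : DForm 𝓘(ℂ, Model k) X (p' + q')} (hΨ : IsBidegree p' q' Ψ) {R R' : ℝ} (hR0 : 0 ≤ R)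
    (hR0' : 0 ≤ R')
    (hR : ∀ (x : X) (v : Fin (p + q) → TangentSpace 𝓘(ℂ, Model k) x),
      (∀ i, (η.form x ![v i, Complex.I • v i]).re ≤ 1) → ‖Φ x v‖ ≤ R)
    (hR' : ∀ (x : X) (v : Fin (p' + q') → TangentSpace 𝓘(ℂ, Model k) x),
      (∀ i, (η.form x ![v i, Complex.I • v i]).re ≤ 1) → ‖Ψ x v‖ ≤ R')
    {x y : X} (L : Model k →ₗ[ℂ] TangentSpace 𝓘(ℂ, Model k) x)
    (L' : Model k →ₗ[ℂ] TangentSpace 𝓘(ℂ, Model k) y) :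
    ‖wedgeAt ((Φ x).compLinearMap (L.restrictScalars ℝ))
      ((Ψ y).compLinearMap (L'.restrictScalars ℝ)) (fun j => frame k (Fin.cast hn j))‖ ≤
      (Fintype.card (Fin (p + q) → Fin k × Bool) * Fintype.card (Fin (p' + q') → Fin k × Bool) *
        (R * R') * 2 ^ k) *
        (√(gram (η.pullCoord L) (η.pullCoord L') p p' hp) *
          √(gram (η.pullCoord L) (η.pullCoord L') q q' hq)) := by
  refine Corr.norm_wedgeAt_frame_le _ _ hp hq rfl rfl hn hR0 hR0' ?_ ?_
  · refine HasExpansion.compLinearMap (hasExpansion_of_bounded _ _ hR0 (hΦ x) fun v hv => ?_) L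
    rw [← η.form_eq] at hv
    exact hR x v hv
  · refine HasExpansion.compLinearMap (hasExpansion_of_bounded _ _ hR0' (hΨ y) fun v hv => ?_) L'
    rw [← η.form_eq] at hv
    exact hR' y v hv

/-- The differential of the first projection of the parametrisation given by a slice chart. -/
noncomputable def sliceFst
    (ψ : OpenPartialHomeomorph (X × X) (ModelProd (Model k) (Model k))) (u : Model k) :
    Model k →ₗ[ℂ] TangentSpace 𝓘(ℂ, Model k) (sliceParam ψ u).1 :=
  (mfderiv (sqModel k) 𝓘(ℂ, Model k) (Prod.fst : X × X → X) (sliceParam ψ u)).toLinearMap.comp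
    (mfderiv 𝓘(ℂ, Model k) (sqModel k) (sliceParam ψ) u).toLinearMap

/-- The differential of the second projection of the parametrisation given by a slice chart. -/
noncomputable def sliceSnd
    (ψ : OpenPartialHomeomorph (X × X) (ModelProd (Model k) (Model k))) (u : Model k) :
    Model k →ₗ[ℂ] TangentSpace 𝓘(ℂ, Model k) (sliceParam ψ u).2 :=
  (mfderiv (sqModel k) 𝓘(ℂ, Model k) (Prod.snd : X × X → X) (sliceParam ψ u)).toLinearMap.comp
    (mfderiv 𝓘(ℂ, Model k) (sqModel k) (sliceParam ψ) u).toLinearMap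

theorem sliceDensity_pull₂_pull₁ {m n : ℕ} (hn : m + n = 2 * k)
    (Φ : DForm 𝓘(ℂ, Model k) X m) (Ψ : DForm 𝓘(ℂ, Model k) X n)
    (ψ : OpenPartialHomeomorph (X × X) (ModelProd (Model k) (Model k))) (u : Model k) :
    sliceDensity hn (wedge (pull₂ Φ) (pull₁ Ψ)) ψ u =
      wedgeAt ((Φ (sliceParam ψ u).2).compLinearMap ((sliceSnd ψ u).restrictScalars ℝ))
        ((Ψ (sliceParam ψ u).1).compLinearMap ((sliceFst ψ u).restrictScalars ℝ))
        (fun j => frame k (Fin.cast hn j)) := by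
  unfold sliceDensity pullback wedge
  rw [wedgeAt_compLinearMap]
  rfl

theorem sliceDensity_pull₁_pull₂ {m n : ℕ} (hn : m + n = 2 * k)
    (Φ : DForm 𝓘(ℂ, Model k) X m) (Ψ : DForm 𝓘(ℂ, Model k) X n)
    (ψ : OpenPartialHomeomorph (X × X) (ModelProd (Model k) (Model k))) (u : Model k) :
    sliceDensity hn (wedge (pull₁ Φ) (pull₂ Ψ)) ψ u =
      wedgeAt ((Φ (sliceParam ψ u).1).compLinearMap ((sliceFst ψ u).restrictScalars ℝ))
        ((Ψ (sliceParam ψ u).2).compLinearMap ((sliceSnd ψ u).restrictScalars ℝ))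
        (fun j => frame k (Fin.cast hn j)) := by
  unfold sliceDensity pullback wedge
  rw [wedgeAt_compLinearMap]
  rfl

/-- In particular this density is nonnegative, so passing to `ENNReal.ofReal` loses nothing. -/
theorem sliceDensity_wedgePow_re (η : HermitianForm k X) {a b : ℕ} (h : k = a + b)
    (hn : 2 * a + 2 * b = 2 * k)
    (ψ : OpenPartialHomeomorph (X × X) (ModelProd (Model k) (Model k))) (u : Model k) :
    (sliceDensity hn (wedge (pull₂ (wedgePow η.form a)) (pull₁ (wedgePow η.form b))) ψ u).re =
      gram (η.pullCoord (sliceSnd ψ u)) (η.pullCoord (sliceFst ψ u)) a b h := by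
  rw [sliceDensity_pull₂_pull₁, η.wedgeAt_wedgePow_frame _ _ h hn, Complex.ofReal_re]

theorem contMDiffAt_sliceParam {A : Set (X × X)}
    {ψ : OpenPartialHomeomorph (X × X) (ModelProd (Model k) (Model k))} (hψ : IsSliceChart A ψ)
    {u : Model k} (hu : u ∈ sliceDomain ψ) :
    ContMDiffAt 𝓘(ℂ, Model k) (sqModel k) ω (sliceParam ψ) u := by
  have h1 : ContMDiffAt 𝓘(ℂ, Model k) (sqModel k) ω
      (fun u : Model k => ((u, 0) : Model k × Model k)) u :=
    contMDiffAt_id.prodMk contMDiffAt_const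
  have h2 := contMDiffAt_symm_of_mem_maximalAtlas hψ.1 hu
  have h3 : chartedSpaceSelf (ModelProd (Model k) (Model k)) =
      prodChartedSpace (Model k) (Model k) (Model k) (Model k) := chartedSpaceSelf_prod.symm
  rw [h3] at h2
  exact ContMDiffAt.comp (I' := sqModel k) u h2 h1

variable [IsManifold 𝓘(ℂ, Model k) ω X]

/-- The density is that of the powers of the pullbacks of `η` under the two holomorphic maps
`u ↦ π_i(ψ⁻¹(u, 0))`. -/
theorem continuousOn_sliceDensity (η : HermitianForm k X) {A : Set (X × X)}
    {ψ : OpenPartialHomeomorph (X × X) (ModelProd (Model k) (Model k))} (hψ : IsSliceChart A ψ)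
    {a b : ℕ} (hn : 2 * a + 2 * b = 2 * k) :
    ContinuousOn (sliceDensity hn (wedge (pull₂ (wedgePow η.form a))
      (pull₁ (wedgePow η.form b))) ψ) (sliceDomain ψ) := by
  have hI : IsManifold 𝓘(ℂ, Model k) 1 X := IsManifold.of_le (n := ω) (by simp)
  have hfst : ∀ u ∈ sliceDomain ψ, ContMDiffAt 𝓘(ℂ, Model k) 𝓘(ℂ, Model k) ω
      (fun u => (sliceParam ψ u).1) u := fun u hu => (contMDiffAt_sliceParam hψ hu).fst
  have hsnd : ∀ u ∈ sliceDomain ψ, ContMDiffAt 𝓘(ℂ, Model k) 𝓘(ℂ, Model k) ω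
      (fun u => (sliceParam ψ u).2) u := fun u hu => (contMDiffAt_sliceParam hψ hu).snd
  let φ₁ : Model k → Model k [⋀^Fin 2]→ₗ[ℝ] ℂ := fun u =>
    pullback 𝓘(ℂ, Model k) 𝓘(ℂ, Model k) (fun u => (sliceParam ψ u).1) η.form u
  let φ₂ : Model k → Model k [⋀^Fin 2]→ₗ[ℝ] ℂ := fun u =>
    pullback 𝓘(ℂ, Model k) 𝓘(ℂ, Model k) (fun u => (sliceParam ψ u).2) η.form u
  have heq : ∀ u ∈ sliceDomain ψ, sliceDensity hn (wedge (pull₂ (wedgePow η.form a))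
      (pull₁ (wedgePow η.form b))) ψ u =
      wedgeAt (wedgePowAt (φ₂ u) a) (wedgePowAt (φ₁ u) b)
        (fun j => frame k (Fin.cast hn j)) := by
    intro u hu
    have hmd := (contMDiffAt_sliceParam hψ hu).mdifferentiableAt (by simp)
    have h1 : mfderiv 𝓘(ℂ, Model k) 𝓘(ℂ, Model k) (fun u => (sliceParam ψ u).1) u =
        (mfderiv (sqModel k) 𝓘(ℂ, Model k) (Prod.fst : X × X → X) (sliceParam ψ u)).comp
          (mfderiv 𝓘(ℂ, Model k) (sqModel k) (sliceParam ψ) u) :=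
      mfderiv_comp u mdifferentiableAt_fst hmd
    have h2 : mfderiv 𝓘(ℂ, Model k) 𝓘(ℂ, Model k) (fun u => (sliceParam ψ u).2) u =
        (mfderiv (sqModel k) 𝓘(ℂ, Model k) (Prod.snd : X × X → X) (sliceParam ψ u)).comp
          (mfderiv 𝓘(ℂ, Model k) (sqModel k) (sliceParam ψ) u) :=
      mfderiv_comp u mdifferentiableAt_snd hmd
    have h3 : φ₁ u = (η.form (sliceParam ψ u).1).compLinearMap
        ((sliceFst ψ u).restrictScalars ℝ) := by
      simp only [φ₁, pullback, h1]
      rfl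
    have h4 : φ₂ u = (η.form (sliceParam ψ u).2).compLinearMap
        ((sliceSnd ψ u).restrictScalars ℝ) := by
      simp only [φ₂, pullback, h2]
      rfl
    rw [sliceDensity_pull₂_pull₁, wedgePow_apply, wedgePow_apply, wedgePowAt_compLinearMap,
      wedgePowAt_compLinearMap, h3, h4]
  refine ContinuousOn.congr (fun u hu => ContinuousAt.continuousWithinAt ?_) heq
  exact tendsto_wedgeAt
    (fun v => tendsto_wedgePowAt (fun w => η.smooth.tendsto_pullback (hsnd u hu) w) a v)
    (fun v => tendsto_wedgePowAt (fun w => η.smooth.tendsto_pullback (hfst u hu) w) b v) _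

end Density

/-! ### Cauchy–Schwarz inequalities for integrals over cycles -/

section CauchySchwarz

theorem tsum_rpow_half_mul_le {ι : Type*} (f g : ι → ℝ≥0∞) :
    ∑' i, f i ^ (1 / 2 : ℝ) * g i ^ (1 / 2 : ℝ) ≤
      (∑' i, f i) ^ (1 / 2 : ℝ) * (∑' i, g i) ^ (1 / 2 : ℝ) := by
  have hpq : (2 : ℝ).HolderConjugate 2 := Real.HolderConjugate.two_two
  have h2 : ∀ x : ℝ≥0∞, (x ^ (1 / 2 : ℝ)) ^ (2 : ℝ) = x := by
    intro x
    rw [← ENNReal.rpow_mul]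
    norm_num
  rw [ENNReal.tsum_eq_iSup_sum]
  refine iSup_le fun s => ?_
  refine (ENNReal.inner_le_Lp_mul_Lq s _ _ hpq).trans ?_
  simp only [h2]
  gcongr <;> exact ENNReal.sum_le_tsum s

theorem lintegral_rpow_half_mul_le {α : Type*} [MeasurableSpace α] (μ : Measure α)
    {f g : α → ℝ≥0∞} (hf : AEMeasurable f μ) (hg : AEMeasurable g μ) :
    ∫⁻ a, f a ^ (1 / 2 : ℝ) * g a ^ (1 / 2 : ℝ) ∂μ ≤
      (∫⁻ a, f a ∂μ) ^ (1 / 2 : ℝ) * (∫⁻ a, g a ∂μ) ^ (1 / 2 : ℝ) := by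
  have hpq : (2 : ℝ).HolderConjugate 2 := Real.HolderConjugate.two_two
  have h2 : ∀ x : ℝ≥0∞, (x ^ (1 / 2 : ℝ)) ^ (2 : ℝ) = x := by
    intro x
    rw [← ENNReal.rpow_mul]
    norm_num
  have h := ENNReal.lintegral_mul_le_Lp_mul_Lq μ hpq (hf.pow_const (1 / 2 : ℝ))
    (hg.pow_const (1 / 2 : ℝ))
  simpa only [h2, Pi.mul_apply] using h

variable {k : ℕ} {X : Type*} [TopologicalSpace X] [ChartedSpace (Model k) X] [CompactSpace X]

/-- If a form is dominated pointwise by the geometric mean of two nonnegative forms, then so is its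
integral over every cycle. -/
theorem enorm_cycleIntegral_le {n n₁ n₂ : ℕ} (hn : n = 2 * k) (hn₁ : n₁ = 2 * k)
    (hn₂ : n₂ = 2 * k) {β : DForm (sqModel k) (X × X) n} {β₁ : DForm (sqModel k) (X × X) n₁}
    {β₂ : DForm (sqModel k) (X × X) n₂} {C : ℝ≥0∞}
    (hβ : ∀ ψ u, ‖sliceDensity hn β ψ u‖ₑ ≤
      C * (ENNReal.ofReal (sliceDensity hn₁ β₁ ψ u).re ^ (1 / 2 : ℝ) *
        ENNReal.ofReal (sliceDensity hn₂ β₂ ψ u).re ^ (1 / 2 : ℝ)))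
    (h₁ : ∀ (A : Set (X × X)) ψ, IsSliceChart A ψ →
      ContinuousOn (sliceDensity hn₁ β₁ ψ) (sliceDomain ψ))
    (h₂ : ∀ (A : Set (X × X)) ψ, IsSliceChart A ψ →
      ContinuousOn (sliceDensity hn₂ β₂ ψ) (sliceDomain ψ)) (Γ : Cycle X) :
    ‖cycleIntegral hn Γ β‖ₑ ≤
      C * (cyclePosIntegral hn₁ Γ β₁ ^ (1 / 2 : ℝ) * cyclePosIntegral hn₂ Γ β₂ ^ (1 / 2 : ℝ)) := by
  have hmeas : ∀ {m : ℕ} (hm : m = 2 * k) {β' : DForm (sqModel k) (X × X) m},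
      (∀ (A : Set (X × X)) ψ, IsSliceChart A ψ →
        ContinuousOn (sliceDensity hm β' ψ) (sliceDomain ψ)) →
      ∀ (A : Set (X × X)) (ψ : ℕ → OpenPartialHomeomorph (X × X) (ModelProd (Model k) (Model k))),
        (∀ i, IsSliceChart A (ψ i)) → ∀ i, AEMeasurable
          (fun u => ENNReal.ofReal (sliceDensity hm β' (ψ i) u).re)
          (volume.restrict (slicePiece ψ i)) := by
    intro m hm β' h A ψ hψ i
    have hc : ContinuousOn (fun u => ENNReal.ofReal (sliceDensity hm β' (ψ i) u).re)
        (sliceDomain (ψ i)) :=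
      (ENNReal.continuous_ofReal.comp Complex.continuous_re).comp_continuousOn (h A _ (hψ i))
    exact (hc.aemeasurable (isOpen_sliceDomain _).measurableSet).mono_set fun u hu => hu.1
  have hA : ∀ A : Set (X × X), ‖integral hn A β‖ₑ ≤
      C * (posIntegral hn₁ A β₁ ^ (1 / 2 : ℝ) * posIntegral hn₂ A β₂ ^ (1 / 2 : ℝ)) := by
    intro A
    by_cases h : (regLocus k A).Nonempty
    · simp only [integral, posIntegral, dif_pos h]
      have hψ := (Classical.choose_spec (exists_sliceCover A h)).1
      generalize Classical.choose (exists_sliceCover A h) = ψ at hψ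
      calc ‖∑' i, ∫ u in slicePiece ψ i, sliceDensity hn β (ψ i) u‖ₑ
          ≤ ∑' i, ‖∫ u in slicePiece ψ i, sliceDensity hn β (ψ i) u‖ₑ := enorm_tsum_le_tsum_enorm
        _ ≤ ∑' i, C * ((∫⁻ u in slicePiece ψ i,
                ENNReal.ofReal (sliceDensity hn₁ β₁ (ψ i) u).re) ^ (1 / 2 : ℝ) *
              (∫⁻ u in slicePiece ψ i,
                ENNReal.ofReal (sliceDensity hn₂ β₂ (ψ i) u).re) ^ (1 / 2 : ℝ)) := by
            refine ENNReal.tsum_le_tsum fun i => ?_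
            have m₁ := hmeas hn₁ h₁ A ψ hψ i
            have m₂ := hmeas hn₂ h₂ A ψ hψ i
            refine (enorm_integral_le_lintegral_enorm _).trans ?_
            refine (lintegral_mono fun u => hβ (ψ i) u).trans ?_
            have m₃ : AEMeasurable (fun u =>
                ENNReal.ofReal (sliceDensity hn₁ β₁ (ψ i) u).re ^ (1 / 2 : ℝ) *
                  ENNReal.ofReal (sliceDensity hn₂ β₂ (ψ i) u).re ^ (1 / 2 : ℝ))
                (volume.restrict (slicePiece ψ i)) := (m₁.pow_const _).mul (m₂.pow_const _)
            rw [lintegral_const_mul'' _ m₃]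
            gcongr
            exact lintegral_rpow_half_mul_le _ m₁ m₂
        _ ≤ _ := by
            rw [ENNReal.tsum_mul_left]
            gcongr
            exact tsum_rpow_half_mul_le _ _
    · simp [integral, h]
  have hsq : ∀ x : ℝ≥0∞, x ^ (1 / 2 : ℝ) * x ^ (1 / 2 : ℝ) = x := by
    intro x
    rw [← ENNReal.rpow_add_of_nonneg _ _ (by norm_num) (by norm_num)]
    norm_num
  calc ‖cycleIntegral hn Γ β‖ₑ ≤ ∑' A : Set (X × X), ‖(Γ A : ℂ) * integral hn A β‖ₑ :=
        enorm_tsum_le_tsum_enorm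
    _ ≤ ∑' A : Set (X × X), C * (((Γ A : ℝ≥0∞) * posIntegral hn₁ A β₁) ^ (1 / 2 : ℝ) *
          ((Γ A : ℝ≥0∞) * posIntegral hn₂ A β₂) ^ (1 / 2 : ℝ)) := by
        refine ENNReal.tsum_le_tsum fun A => ?_
        have hΓ : ‖(Γ A : ℂ)‖ₑ = (Γ A : ℝ≥0∞) := by
          rw [← ofReal_norm, Complex.norm_natCast, ENNReal.ofReal_natCast]
        rw [enorm_mul, hΓ, ENNReal.mul_rpow_of_nonneg _ _ (by norm_num),
          ENNReal.mul_rpow_of_nonneg _ _ (by norm_num), mul_mul_mul_comm, hsq, mul_left_comm]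
        gcongr
        exact hA A
    _ ≤ _ := by
        rw [ENNReal.tsum_mul_left]
        gcongr
        exact tsum_rpow_half_mul_le _ _

end CauchySchwarz

/-! ### Mass estimates -/

section Mass

variable {k : ℕ} {X : Type*} [TopologicalSpace X] [ChartedSpace (Model k) X]
  [IsManifold 𝓘(ℂ, Model k) ω X] [CompactSpace X]

/-- Forms bounded by `1` for one Hermitian metric are uniformly bounded for any other one. -/
theorem exists_bound_of_unitBounded (η η' : HermitianForm k X) (n : ℕ) :
    ∃ R : ℝ, 0 ≤ R ∧ ∀ Ψ : DForm 𝓘(ℂ, Model k) X n, UnitBounded η' Ψ →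
      ∀ (x : X) (v : Fin n → TangentSpace 𝓘(ℂ, Model k) x),
        (∀ i, (η.form x ![v i, Complex.I • v i]).re ≤ 1) → ‖Ψ x v‖ ≤ R := by
  obtain ⟨S, hS0, hS⟩ := η'.smooth.exists_bound η
  have hs : 0 < √(S + 1) := Real.sqrt_pos.2 (by linarith)
  refine ⟨√(S + 1) ^ n, by positivity, fun Ψ hΨ x v hv => ?_⟩
  have hunit : ∀ i, (η'.form x ![(√(S + 1))⁻¹ • v i, Complex.I • (√(S + 1))⁻¹ • v i]).re ≤ 1 := by
    intro i
    have h1 : ‖η'.form x ![v i, Complex.I • v i]‖ ≤ S := by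
      refine hS x _ fun j => ?_
      fin_cases j
      · exact hv i
      · have h2 := η.bidegree x Complex.I ![v i, Complex.I • v i]
        have h3 : (fun j => Complex.I • (![v i, Complex.I • v i] :
            Fin 2 → TangentSpace 𝓘(ℂ, Model k) x) j) =
            ![Complex.I • v i, Complex.I • Complex.I • v i] := by
          funext j
          fin_cases j <;> rfl
        rw [h3] at h2
        refine le_trans (le_of_eq (congrArg Complex.re ?_)) (hv i)
        refine h2.trans ?_
        simp
    have h2 : ![(√(S + 1))⁻¹ • v i, Complex.I • (√(S + 1))⁻¹ • v i] =
        fun j => (√(S + 1))⁻¹ • (![v i, Complex.I • v i] :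
            Fin 2 → TangentSpace 𝓘(ℂ, Model k) x) j := by
      funext j
      fin_cases j
      · rfl
      · exact smul_comm _ _ _
    rw [h2, AlternatingMap.map_smul_univ]
    simp only [Finset.prod_const, Finset.card_univ, Fintype.card_fin, Complex.real_smul,
      Complex.re_ofReal_mul]
    rw [inv_pow, Real.sq_sqrt (by linarith), inv_mul_le_iff₀ (by linarith)]
    linarith [(Complex.re_le_norm _).trans h1]
  have h := hΨ x (fun i => (√(S + 1))⁻¹ • v i) hunit
  rw [AlternatingMap.map_smul_univ] at h
  simp only [Finset.prod_const, Finset.card_univ, Fintype.card_fin] at h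
  rw [norm_smul, norm_pow, norm_inv, Real.norm_of_nonneg hs.le, inv_pow,
    inv_mul_le_iff₀ (by positivity), mul_one] at h
  exact h

theorem enorm_le_of_norm_le_sqrt {z : ℂ} {C s t : ℝ} (hC : 0 ≤ C) (hs : 0 ≤ s) (ht : 0 ≤ t)
    (h : ‖z‖ ≤ C * (√s * √t)) :
    ‖z‖ₑ ≤ ENNReal.ofReal C *
      (ENNReal.ofReal s ^ (1 / 2 : ℝ) * ENNReal.ofReal t ^ (1 / 2 : ℝ)) := by
  rw [← ofReal_norm, ENNReal.ofReal_rpow_of_nonneg hs (by norm_num),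
    ENNReal.ofReal_rpow_of_nonneg ht (by norm_num), ← Real.sqrt_eq_rpow, ← Real.sqrt_eq_rpow,
    ← ENNReal.ofReal_mul (Real.sqrt_nonneg _), ← ENNReal.ofReal_mul hC]
  exact ENNReal.ofReal_le_ofReal h

/-- The pointwise bound for a fixed form and all test forms of `C^0`-norm at most `1`. -/
theorem exists_norm_wedgeAt_frame_le (η η' : HermitianForm k X) {p q p' q' : ℕ}
    (hp : k = p + p') (hq : k = q + q') {Φ : DForm 𝓘(ℂ, Model k) X (p + q)}
    (hΦ : IsSmoothForm Φ) (hΦpq : IsBidegree p q Φ) (hn : (p + q) + (p' + q') = 2 * k) :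
    ∃ C : ℝ, 0 ≤ C ∧ ∀ Ψ : DForm 𝓘(ℂ, Model k) X (p' + q'), IsBidegree p' q' Ψ →
      UnitBounded η' Ψ → ∀ (x y : X) (L : Model k →ₗ[ℂ] TangentSpace 𝓘(ℂ, Model k) x)
        (L' : Model k →ₗ[ℂ] TangentSpace 𝓘(ℂ, Model k) y),
        ‖wedgeAt ((Φ x).compLinearMap (L.restrictScalars ℝ))
          ((Ψ y).compLinearMap (L'.restrictScalars ℝ)) (fun j => frame k (Fin.cast hn j))‖ ≤
          C * (√(gram (η.pullCoord L) (η.pullCoord L') p p' hp) *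
            √(gram (η.pullCoord L) (η.pullCoord L') q q' hq)) := by
  obtain ⟨R, hR0, hR⟩ := hΦ.exists_bound η
  obtain ⟨R', hR0', hR'⟩ := exists_bound_of_unitBounded η η' (p' + q')
  exact ⟨Fintype.card (Fin (p + q) → Fin k × Bool) * Fintype.card (Fin (p' + q') → Fin k × Bool) *
    (R * R') * 2 ^ k, by positivity, fun Ψ hΨ hΨ' x y L L' =>
    η.norm_wedgeAt_frame_le hp hq hn hΦpq hΨ hR0 hR0' hR (hR' Ψ hΨ') L L'⟩

/-- The mass of `g^*Φ` is controlled by the intermediate degrees of `g`, with a constant which does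
not depend on the correspondence `g`. -/
theorem exists_mass_pullCurrent_le (η η' : HermitianForm k X) {p q p' q' : ℕ}
    (hp : k = p + p') (hq : k = q + q') {Φ : DForm 𝓘(ℂ, Model k) X (p + q)}
    (hΦ : IsSmoothForm Φ) (hΦpq : IsBidegree p q Φ) (hn : (p + q) + (p' + q') = 2 * k)
    (hnp : 2 * p + 2 * p' = 2 * k) (hnq : 2 * q + 2 * q' = 2 * k) :
    ∃ C : ℝ, ∀ Γ : Cycle X, mass η' (r := p') (s := q') (pullCurrent Γ hn Φ) ≤
      ENNReal.ofReal C *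
        (cyclePosIntegral hnp Γ
          (wedge (pull₂ (wedgePow η.form p)) (pull₁ (wedgePow η.form p'))) ^ (1 / 2 : ℝ) *
        cyclePosIntegral hnq Γ
          (wedge (pull₂ (wedgePow η.form q)) (pull₁ (wedgePow η.form q'))) ^ (1 / 2 : ℝ)) := by
  obtain ⟨C, hC0, hC⟩ := exists_norm_wedgeAt_frame_le η η' hp hq hΦ hΦpq hn
  refine ⟨C, fun Γ => iSup₂_le fun Ψ hΨ => enorm_cycleIntegral_le hn hnp hnq (fun ψ u => ?_)
    (fun A ψ hψ => continuousOn_sliceDensity η hψ hnp)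
    (fun A ψ hψ => continuousOn_sliceDensity η hψ hnq) Γ⟩
  rw [sliceDensity_wedgePow_re η hp, sliceDensity_wedgePow_re η hq]
  refine enorm_le_of_norm_le_sqrt hC0 (gram_nonneg _ _ _ _ _) (gram_nonneg _ _ _ _ _) ?_
  rw [sliceDensity_pull₂_pull₁]
  exact hC Ψ hΨ.2.1 hΨ.2.2 _ _ _ _

/-- The mass of `g_*Φ` is controlled by the intermediate degrees of `g`, with a constant which does
not depend on the correspondence `g`. -/
theorem exists_mass_pushCurrent_le (η η' : HermitianForm k X) {p q p' q' : ℕ}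
    (hp : k = p + p') (hq : k = q + q') {Φ : DForm 𝓘(ℂ, Model k) X (p + q)}
    (hΦ : IsSmoothForm Φ) (hΦpq : IsBidegree p q Φ) (hn : (p + q) + (p' + q') = 2 * k)
    (hnp : 2 * p' + 2 * p = 2 * k) (hnq : 2 * q' + 2 * q = 2 * k) :
    ∃ C : ℝ, ∀ Γ : Cycle X, mass η' (r := p') (s := q') (pushCurrent Γ hn Φ) ≤
      ENNReal.ofReal C *
        (cyclePosIntegral hnp Γ
          (wedge (pull₂ (wedgePow η.form p')) (pull₁ (wedgePow η.form p))) ^ (1 / 2 : ℝ) *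
        cyclePosIntegral hnq Γ
          (wedge (pull₂ (wedgePow η.form q')) (pull₁ (wedgePow η.form q))) ^ (1 / 2 : ℝ)) := by
  have hp' : k = p' + p := by omega
  have hq' : k = q' + q := by omega
  obtain ⟨C, hC0, hC⟩ := exists_norm_wedgeAt_frame_le η η' hp hq hΦ hΦpq hn
  refine ⟨C, fun Γ => iSup₂_le fun Ψ hΨ => enorm_cycleIntegral_le hn hnp hnq (fun ψ u => ?_)
    (fun A ψ hψ => continuousOn_sliceDensity η hψ hnp)
    (fun A ψ hψ => continuousOn_sliceDensity η hψ hnq) Γ⟩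
  rw [sliceDensity_wedgePow_re η hp', sliceDensity_wedgePow_re η hq',
    gram_comm _ _ p' p hp' hp, gram_comm _ _ q' q hq' hq]
  refine enorm_le_of_norm_le_sqrt hC0 (gram_nonneg _ _ _ _ _) (gram_nonneg _ _ _ _ _) ?_
  rw [sliceDensity_pull₁_pull₂]
  exact hC Ψ hΨ.2.1 hΨ.2.2 _ _ _ _

end Mass

/-! ### Growth rates -/

/-- A geometric mean of two sequences grows at most like the geometric mean of their growth rates;
a constant factor does not matter. -/
theorem limsup_root_le {m a b : ℕ → ℝ≥0∞} {C : ℝ}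
    (h : ∀ n, m n ≤ ENNReal.ofReal C * (a n ^ (1 / 2 : ℝ) * b n ^ (1 / 2 : ℝ)))
    (h₁ : ¬ (limsup (fun n : ℕ => a n ^ (1 / (n : ℝ))) atTop = 0 ∧
      limsup (fun n : ℕ => b n ^ (1 / (n : ℝ))) atTop = ⊤))
    (h₂ : ¬ (limsup (fun n : ℕ => a n ^ (1 / (n : ℝ))) atTop = ⊤ ∧
      limsup (fun n : ℕ => b n ^ (1 / (n : ℝ))) atTop = 0)) :
    limsup (fun n : ℕ => m n ^ (1 / (n : ℝ))) atTop ≤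
      (limsup (fun n : ℕ => a n ^ (1 / (n : ℝ))) atTop *
        limsup (fun n : ℕ => b n ^ (1 / (n : ℝ))) atTop) ^ (1 / 2 : ℝ) := by
  let u : ℕ → ℝ≥0∞ := fun n => a n ^ (1 / (n : ℝ))
  let v : ℕ → ℝ≥0∞ := fun n => b n ^ (1 / (n : ℝ))
  have hhalf : ∀ w : ℕ → ℝ≥0∞, limsup (fun n => w n ^ (1 / 2 : ℝ)) atTop =
      limsup w atTop ^ (1 / 2 : ℝ) := fun w =>
    ((ENNReal.orderIsoRpow (1 / 2 : ℝ) (by norm_num)).limsup_apply (u := w)).symm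
  -- the constant has to be positive for its `n`-th roots to tend to `1`
  let D : ℝ := max C 1
  have hD : 0 < D := lt_max_of_lt_right one_pos
  have hlim : Tendsto (fun n : ℕ => ENNReal.ofReal D ^ (1 / (n : ℝ))) atTop (𝓝 1) := by
    have h1 : Tendsto (fun n : ℕ => ENNReal.ofReal (D ^ (1 / (n : ℝ)))) atTop
        (𝓝 (ENNReal.ofReal (D ^ (0 : ℝ)))) :=
      (ENNReal.continuous_ofReal.tendsto _).comp
        (((Real.continuousAt_const_rpow hD.ne').tendsto).comp tendsto_one_div_atTop_nhds_zero_nat)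
    rw [Real.rpow_zero, ENNReal.ofReal_one] at h1
    refine h1.congr fun n => ?_
    rw [ENNReal.ofReal_rpow_of_pos hD]
  have hle : ∀ n : ℕ, m n ^ (1 / (n : ℝ)) ≤
      ((fun n : ℕ => ENNReal.ofReal D ^ (1 / (n : ℝ))) *
        fun n => (u n * v n) ^ (1 / 2 : ℝ)) n := by
    intro n
    have hn : (0 : ℝ) ≤ 1 / (n : ℝ) := by positivity
    calc m n ^ (1 / (n : ℝ))
        ≤ (ENNReal.ofReal D * (a n ^ (1 / 2 : ℝ) * b n ^ (1 / 2 : ℝ))) ^ (1 / (n : ℝ)) := by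
          gcongr
          exact (h n).trans (by gcongr; exact le_max_left _ _)
      _ = _ := by
          simp only [Pi.mul_apply, u, v]
          rw [ENNReal.mul_rpow_of_nonneg _ _ hn, ENNReal.mul_rpow_of_nonneg _ _ hn,
            ENNReal.mul_rpow_of_nonneg _ _ (by norm_num), ← ENNReal.rpow_mul, ← ENNReal.rpow_mul,
            ← ENNReal.rpow_mul, ← ENNReal.rpow_mul, mul_comm (1 / 2 : ℝ)]
  refine (limsup_le_limsup (Eventually.of_forall hle)).trans ?_
  have hlim1 := hlim.limsup_eq
  refine (ENNReal.limsup_mul_le' (Or.inl ?_) (Or.inl ?_)).trans ?_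
  · rw [hlim1]
    exact one_ne_zero
  · rw [hlim1]
    exact ENNReal.one_ne_top
  · rw [hlim1, one_mul, hhalf fun n => u n * v n]
    gcongr
    exact ENNReal.limsup_mul_le' (not_and_or.1 h₁) (not_and_or.1 h₂)

end Corr

theorem lemma4p1 {k : ℕ} {X : Type*} [TopologicalSpace X] [T2Space X] [CompactSpace X]
    [ChartedSpace (Corr.Model k) X] [IsManifold 𝓘(ℂ, Corr.Model k) ω X]
    (η η' : Corr.HermitianForm k X) (f : Corr.MeroCorr k X)
    {p q : ℕ} (hp : p ≤ k) (hq : q ≤ k)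
    (Φ : Corr.DForm 𝓘(ℂ, Corr.Model k) X (p + q))
    (hΦ : Corr.IsSmoothForm Φ) (hΦpq : Corr.IsBidegree p q Φ) :
    (¬ (Corr.dynDegree η f p hp = 0 ∧ Corr.dynDegree η f q hq = ⊤) →
      ¬ (Corr.dynDegree η f p hp = ⊤ ∧ Corr.dynDegree η f q hq = 0) →
      limsup (fun n : ℕ => Corr.mass η' (r := k - p) (s := k - q)
          (Corr.pullCurrent (Corr.iter k f.graph n)
            (show (p + q) + ((k - p) + (k - q)) = 2 * k by omega) Φ) ^ (1 / (n : ℝ))) atTop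
        ≤ (Corr.dynDegree η f p hp * Corr.dynDegree η f q hq) ^ (1 / 2 : ℝ)) ∧
    (¬ (Corr.dynDegree η f (k - p) (Nat.sub_le k p) = 0 ∧
        Corr.dynDegree η f (k - q) (Nat.sub_le k q) = ⊤) →
      ¬ (Corr.dynDegree η f (k - p) (Nat.sub_le k p) = ⊤ ∧
        Corr.dynDegree η f (k - q) (Nat.sub_le k q) = 0) →
      limsup (fun n : ℕ => Corr.mass η' (r := k - p) (s := k - q)
          (Corr.pushCurrent (Corr.iter k f.graph n)
            (show (p + q) + ((k - p) + (k - q)) = 2 * k by omega) Φ) ^ (1 / (n : ℝ))) atTop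
        ≤ (Corr.dynDegree η f (k - p) (Nat.sub_le k p) *
            Corr.dynDegree η f (k - q) (Nat.sub_le k q)) ^ (1 / 2 : ℝ)) := by
  refine ⟨fun h₁ h₂ => ?_, fun h₁ h₂ => ?_⟩
  · obtain ⟨C, hC⟩ := Corr.exists_mass_pullCurrent_le η η' (Nat.add_sub_cancel' hp).symm
      (Nat.add_sub_cancel' hq).symm hΦ hΦpq (by omega) (by omega) (by omega)
    exact Corr.limsup_root_le (fun n => hC (Corr.iter k f.graph n)) h₁ h₂
  · obtain ⟨C, hC⟩ := Corr.exists_mass_pushCurrent_le η η' (Nat.add_sub_cancel' hp).symm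
      (Nat.add_sub_cancel' hq).symm hΦ hΦpq (by omega) (by omega) (by omega)
    -- `dynDegree` at `k - r` is stated with the exponent `k - (k - r)` on the first factor
    have hdeg : ∀ (r : ℕ) (hr : r ≤ k), Corr.dynDegree η f (k - r) (Nat.sub_le k r) =
        limsup (fun n : ℕ => Corr.cyclePosIntegral (show 2 * (k - r) + 2 * r = 2 * k by omega)
          (Corr.iter k f.graph n) (Corr.wedge (Corr.pull₂ (Corr.wedgePow η.form (k - r)))
            (Corr.pull₁ (Corr.wedgePow η.form r))) ^ (1 / (n : ℝ))) atTop := by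
      intro r hr
      have hgen : ∀ (s : ℕ) (hs : s = r) (h : 2 * (k - r) + 2 * s = 2 * k),
          limsup (fun n : ℕ => Corr.cyclePosIntegral h
            (Corr.iter k f.graph n) (Corr.wedge (Corr.pull₂ (Corr.wedgePow η.form (k - r)))
              (Corr.pull₁ (Corr.wedgePow η.form s))) ^ (1 / (n : ℝ))) atTop =
          limsup (fun n : ℕ => Corr.cyclePosIntegral
            (show 2 * (k - r) + 2 * r = 2 * k by omega)
            (Corr.iter k f.graph n) (Corr.wedge (Corr.pull₂ (Corr.wedgePow η.form (k - r)))
              (Corr.pull₁ (Corr.wedgePow η.form r))) ^ (1 / (n : ℝ))) atTop := by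
        intro s hs h
        subst hs
        rfl
      exact hgen _ (Nat.sub_sub_self hr) _
    rw [hdeg p hp, hdeg q hq] at h₁ h₂ ⊢
    exact Corr.limsup_root_le (fun n => hC (Corr.iter k f.graph n)) h₁ h₂
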